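/- Let $\mathscr F_+$ be the truncated Fourier operator on $L^2(\mathbb R^+)$, $\mathbb R^+=(0,\infty)$, $$(\mathscr F_+x)(t)=\frac1{\sqrt{2\pi}}\int_{\mathbb R^+}x(\xi)e^{it\xi}\,d\xi,\qquad t\in\mathbb R^+,$$ that is, $\mathscr F_+=P\mathscr F|_{L^2(\mathbb R^+)}$, where $\mathscr F$ is the unitary Fourier–Plancherel operator on $L^2(\mathbb R)$ with kernel $(2\pi)^{-1/2}e^{it\xi}$ and $P$ is the restriction to $\mathbb R^+$. Put $$A(z)=\frac{(2|z|^2+1)^{1/2}}2,\qquad B(z)=\frac4{(2|z|^2+1)^{3/2}}.$$ The spectrum $\sigma(\mathscr F_+)$ is the segment $\big[-\tfrac1{\sqrt2}e^{i\pi/4},\tfrac1{\sqrt2}e^{i\pi/4}\big]$. Let $\zeta\in\sigma(\mathscr F_+)$ and let $z\ne\zeta$ lie on the normal to this segment at $\zeta$, i.e. $z=\zeta+te^{3\pi i/4}$ with $t\in\mathbb R\setminus\{0\}$. Then $z\notin\sigma(\mathscr F_+)$, and, with the operator norm on $L^2(\mathbb R^+)$: 1. If $\zeta\neq0$, then $\displaystyle\|(z-\mathscr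 F_+)^{-1}\|\le A(z)\,\frac1{|\zeta|}\cdot\frac1{|z-\zeta|}$. 2. If $|z-\zeta|\le|\zeta|$, then $\displaystyle A(z)\,\frac1{|\zeta|}\cdot\frac1{|z-\zeta|}-B(z)\,|\zeta|\,|z-\zeta|\le\|(z-\mathscr F_+)^{-1}\|$. 3. If $\zeta=0$, then $\displaystyle 2A(z)\frac1{|z|^2}-B(z)\frac{|z|^2}2\le\|(z-\mathscr F_+)^{-1}\|\le2A(z)\frac1{|z|^2}$; in particular $\displaystyle 2A(z)\frac1{|z|^2}-B(z)\le\|(z-\mathscr F_+)^{-1}\|$ whenever $|z|^2\le2$. Consequently, as $z\to\zeta$ along the normal at $\zeta$ ($z\ne\zeta$), $$\|(z-\mathscr F_+)^{-1}\|=\frac{A(\zeta)}{|\zeta|}\,\frac1{|z-\zeta|}+O(1)\quad\text{if }\zeta\ne0,\qquad \|(z-\mathscr F_+)^{-1}\|=|z|^{-2}+O(1)\quad\text{if }\zeta=0,$$ where $O(1)$ is a quantity that remains bounded as $z\to\zeta$. -/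

import Mathlib

open MeasureTheory Set Filter Topology
open scoped FourierTransform

noncomputable section

namespace TruncatedFourier

/-- The complex Hilbert space `L²(ℝ)`. -/
abbrev L2Line : Type := Lp ℂ 2 (volume : Measure ℝ)

/-- The complex Hilbert space `L²(ℝ⁺)`, `ℝ⁺ = (0, ∞)` with Lebesgue measure. -/
abbrev L2Pos : Type := Lp ℂ 2 ((volume : Measure ℝ).restrict (Ioi 0))

lemma two_pi_inv_ne_zero : (2 * Real.pi)⁻¹ ≠ 0 := inv_ne_zero Real.two_pi_pos.ne'

lemma quasiMeasurePreserving_dilation :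
    Measure.QuasiMeasurePreserving (fun t : ℝ => (2 * Real.pi)⁻¹ * t) volume volume := by
  refine ⟨by fun_prop, ?_⟩
  rw [Real.map_volume_mul_left two_pi_inv_ne_zero]
  exact Measure.smul_absolutelyContinuous

lemma eLpNorm_dilation {f : ℝ → ℂ} (hf : AEStronglyMeasurable f volume) :
    eLpNorm (fun t : ℝ => ((Real.sqrt (2 * Real.pi))⁻¹ : ℂ) * f ((2 * Real.pi)⁻¹ * t)) 2 volume
      = eLpNorm f 2 volume := by
  have hpi := Real.two_pi_pos
  have h1 : eLpNorm (fun t : ℝ => f ((2 * Real.pi)⁻¹ * t)) 2 volume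
      = ENNReal.ofReal (Real.sqrt (2 * Real.pi)) * eLpNorm f 2 volume := by
    have hm := Real.map_volume_mul_left two_pi_inv_ne_zero
    have := eLpNorm_map_measure (p := 2) (μ := (volume : Measure ℝ)) (g := f)
      (f := fun t : ℝ => (2 * Real.pi)⁻¹ * t)
      (by rw [hm]; exact hf.smul_measure _) (by fun_prop)
    rw [hm, eLpNorm_smul_measure_of_ne_top (by norm_num)] at this
    rw [show (fun t : ℝ => f ((2 * Real.pi)⁻¹ * t)) = f ∘ fun t : ℝ => (2 * Real.pi)⁻¹ * t
      from rfl, ← this, inv_inv, abs_of_pos hpi, Real.sqrt_eq_rpow, smul_eq_mul]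
    congr 1
    rw [ENNReal.ofReal_rpow_of_pos hpi]
    norm_num
  have h2 := eLpNorm_const_smul (p := 2) (μ := (volume : Measure ℝ))
    ((Real.sqrt (2 * Real.pi))⁻¹ : ℂ) (fun t : ℝ => f ((2 * Real.pi)⁻¹ * t))
  have h3 : ‖((Real.sqrt (2 * Real.pi))⁻¹ : ℂ)‖ₑ
      = ENNReal.ofReal (Real.sqrt (2 * Real.pi))⁻¹ := by
    rw [← ofReal_norm, norm_inv, Complex.norm_real, Real.norm_of_nonneg (by positivity)]
  have h4 : eLpNorm (fun t : ℝ => ((Real.sqrt (2 * Real.pi))⁻¹ : ℂ) * f ((2 * Real.pi)⁻¹ * t))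
      2 volume = ‖((Real.sqrt (2 * Real.pi))⁻¹ : ℂ)‖ₑ *
        eLpNorm (fun t : ℝ => f ((2 * Real.pi)⁻¹ * t)) 2 volume := h2
  rw [h4, h3, h1, ← mul_assoc, ← ENNReal.ofReal_mul (by positivity),
    inv_mul_cancel₀ (by positivity), ENNReal.ofReal_one, one_mul]

lemma memLp_dilation {f : ℝ → ℂ} (hf : MemLp f 2 volume) :
    MemLp (fun t : ℝ => ((Real.sqrt (2 * Real.pi))⁻¹ : ℂ) * f ((2 * Real.pi)⁻¹ * t)) 2 volume := by
  refine ⟨(hf.1.comp_quasiMeasurePreserving quasiMeasurePreserving_dilation).const_mul _, ?_⟩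
  rw [eLpNorm_dilation hf.1]
  exact hf.2

/-- The unitary dilation `f ↦ (2π)^{-1/2} f(t / 2π)` of `L²(ℝ)`. -/
def dilation : L2Line →L[ℂ] L2Line :=
  LinearMap.mkContinuous
    { toFun := fun f => (memLp_dilation (Lp.memLp f)).toLp _
      map_add' := fun f g => by
        rw [← MemLp.toLp_add]
        refine MemLp.toLp_congr _ _ ?_
        filter_upwards [quasiMeasurePreserving_dilation.ae (Lp.coeFn_add f g)] with t ht
        simp only [Pi.add_apply] at ht ⊢
        rw [ht, mul_add]
      map_smul' := fun c f => by
        rw [← MemLp.toLp_const_smul]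
        refine MemLp.toLp_congr _ _ ?_
        filter_upwards [quasiMeasurePreserving_dilation.ae (Lp.coeFn_smul c f)] with t ht
        simp only [Pi.smul_apply, smul_eq_mul, RingHom.id_apply] at ht ⊢
        rw [ht]; ring }
    1 (fun f => by
      simp only [LinearMap.coe_mk, AddHom.coe_mk, one_mul]
      rw [Lp.norm_toLp, eLpNorm_dilation (Lp.aestronglyMeasurable f), Lp.norm_def])

/-- The Fourier–Plancherel operator `(ℱ x)(t) = (2π)^{-1/2} ∫ x(ξ) e^{i t ξ} dξ` on `L²(ℝ)`.
Mathlib's inverse Fourier transform is `∫ x(ξ) e^{2π i s ξ} dξ`, taken here at `s = t / 2π`. -/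
def fourierPlancherel : L2Line →L[ℂ] L2Line :=
  dilation ∘L FourierTransform.fourierInvCLM ℂ L2Line

lemma memLp_indicator_pos (x : L2Pos) :
    MemLp ((Ioi (0 : ℝ)).indicator (x : ℝ → ℂ)) 2 volume :=
  (memLp_indicator_iff_restrict measurableSet_Ioi).2 (Lp.memLp x)

/-- The inclusion `L²(ℝ⁺) ⊆ L²(ℝ)`, extension by zero. -/
def extendZero : L2Pos →L[ℂ] L2Line :=
  LinearMap.mkContinuous
    { toFun := fun x => (memLp_indicator_pos x).toLp _
      map_add' := fun x y => by
        rw [← MemLp.toLp_add]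
        refine MemLp.toLp_congr _ _ ?_
        filter_upwards [(ae_restrict_iff' measurableSet_Ioi).1 (Lp.coeFn_add x y)] with t ht
        by_cases h : t ∈ Ioi (0 : ℝ)
        · simpa [indicator_of_mem h] using ht h
        · simp [indicator_of_notMem h]
      map_smul' := fun c x => by
        rw [← MemLp.toLp_const_smul]
        refine MemLp.toLp_congr _ _ ?_
        filter_upwards [(ae_restrict_iff' measurableSet_Ioi).1 (Lp.coeFn_smul c x)] with t ht
        by_cases h : t ∈ Ioi (0 : ℝ)
        · simpa [indicator_of_mem h] using ht h
        · simp [indicator_of_notMem h] }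
    1 (fun x => by
      simp only [LinearMap.coe_mk, AddHom.coe_mk, one_mul]
      rw [Lp.norm_toLp, eLpNorm_indicator_eq_eLpNorm_restrict measurableSet_Ioi, Lp.norm_def])

/-- The projection of `L²(ℝ)` onto `L²(ℝ⁺)`, restriction to `ℝ⁺`. -/
def restrictPos : L2Line →L[ℂ] L2Pos := LpToLpRestrictCLM ℝ ℂ ℂ volume 2 (Ioi 0)

/-- The truncated Fourier operator `(ℱ₊ x)(t) = (2π)^{-1/2} ∫_{ℝ⁺} x(ξ) e^{i t ξ} dξ`, `t > 0`,
as a bounded operator on `L²(ℝ⁺)`: extend by zero, apply `fourierPlancherel`, restrict. -/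
def truncatedFourier : L2Pos →L[ℂ] L2Pos := restrictPos ∘L fourierPlancherel ∘L extendZero

/-- On `L¹ ∩ L²` the inverse Fourier transform of `L²` is given by the integral. -/
lemma coeFn_fourierInv (f : L2Line) (hf : Integrable (f : ℝ → ℂ) volume) :
    ((𝓕⁻ f : L2Line) : ℝ → ℂ) =ᵐ[volume] 𝓕⁻ (f : ℝ → ℂ) := by
  have hinv : ∀ g : ℝ → ℂ, 𝓕⁻ g = VectorFourier.fourierIntegral Real.fourierChar volume
      (-innerₗ ℝ) g := by
    intro g
    ext t
    simp [Real.fourierInv_eq, VectorFourier.fourierIntegral]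
  have hL : Continuous fun p : ℝ × ℝ => (-innerₗ ℝ) p.1 p.2 := by
    exact (continuous_inner (𝕜 := ℝ) (E := ℝ)).neg
  have hcont : Continuous (𝓕⁻ (f : ℝ → ℂ)) := by
    rw [hinv]
    exact VectorFourier.fourierIntegral_continuous Real.continuous_fourierChar hL hf
  refine ae_eq_of_integral_contDiff_smul_eq
    ((Lp.memLp (𝓕⁻ f : L2Line)).locallyIntegrable (by norm_num)) hcont.locallyIntegrable ?_
  intro g hg hgc
  have hg₁ : HasCompactSupport (Complex.ofRealCLM ∘ g) := hgc.comp_left rfl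
  have hg₂ : ContDiff ℝ (⊤ : ℕ∞) (Complex.ofRealCLM ∘ g) := by fun_prop
  set G : SchwartzMap ℝ ℂ := hg₁.toSchwartzMap hg₂ with hG
  have hGg : ∀ t, G t = (g t : ℂ) := fun t => rfl
  have h1 : ∫ t, G t • (𝓕⁻ f : L2Line) t = ∫ t, (𝓕⁻ G) t • f t := by
    have := congrArg (fun T => T G) (Lp.fourierInv_toTemperedDistribution_eq f)
    simp only [TemperedDistribution.fourierInv_apply, Lp.toTemperedDistribution_apply] at this
    exact this.symm
  have h2 : ∫ t, (𝓕⁻ G) t • f t = ∫ t, G t • (𝓕⁻ (f : ℝ → ℂ)) t := by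
    have := VectorFourier.integral_fourierIntegral_smul_eq_flip (L := -innerₗ ℝ)
      Real.continuous_fourierChar hL (G.integrable (μ := volume)) hf
    rw [← hinv] at this
    rw [hinv]
    have hflip : (-innerₗ ℝ).flip = -innerₗ ℝ := by
      ext; simp
    rw [hflip] at this
    rw [← this, SchwartzMap.fourierInv_coe]
  simpa [hGg] using h1.trans h2

/-- For integrable `x` the operator is given by the defining integral. -/
theorem truncatedFourier_coeFn (x : L2Pos)
    (hx : Integrable (x : ℝ → ℂ) ((volume : Measure ℝ).restrict (Ioi 0))) :
    (truncatedFourier x : ℝ → ℂ) =ᵐ[(volume : Measure ℝ).restrict (Ioi 0)]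
      fun t => ((Real.sqrt (2 * Real.pi))⁻¹ : ℂ) *
        ∫ ξ in Ioi (0 : ℝ), x ξ * Complex.exp (Complex.I * t * ξ) := by
  have he : (extendZero x : ℝ → ℂ) =ᵐ[volume] (Ioi (0 : ℝ)).indicator (x : ℝ → ℂ) :=
    (memLp_indicator_pos x).coeFn_toLp
  have hint : Integrable (extendZero x : ℝ → ℂ) volume :=
    ((integrable_indicator_iff measurableSet_Ioi).2 hx).congr he.symm
  have hd : (fourierPlancherel (extendZero x) : ℝ → ℂ) =ᵐ[volume]
      fun t : ℝ => ((Real.sqrt (2 * Real.pi))⁻¹ : ℂ) *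
        (𝓕⁻ (extendZero x) : L2Line) ((2 * Real.pi)⁻¹ * t) :=
    (memLp_dilation (Lp.memLp (𝓕⁻ (extendZero x) : L2Line))).coeFn_toLp
  have hr : (truncatedFourier x : ℝ → ℂ) =ᵐ[(volume : Measure ℝ).restrict (Ioi 0)]
      (fourierPlancherel (extendZero x) : ℝ → ℂ) :=
    LpToLpRestrictCLM_coeFn ℂ (Ioi 0) (fourierPlancherel (extendZero x))
  filter_upwards [hr, ae_restrict_of_ae hd, ae_restrict_of_ae
    (quasiMeasurePreserving_dilation.ae (coeFn_fourierInv _ hint))] with t h1 h2 h3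
  rw [h1, h2, h3, Real.fourierInv_eq', ← integral_indicator measurableSet_Ioi]
  congr 1
  refine integral_congr_ae ?_
  filter_upwards [he] with ξ hξ
  rw [hξ]
  by_cases h : ξ ∈ Ioi (0 : ℝ)
  · simp only [indicator_of_mem h, smul_eq_mul]
    rw [mul_comm]
    congr 2
    have : (Real.pi : ℂ) ≠ 0 := by exact_mod_cast Real.pi_ne_zero
    simp
    field_simp
  · simp [indicator_of_notMem h]

/-- `A(z) = (2|z|² + 1)^{1/2} / 2`. -/
def A (z : ℂ) : ℝ := Real.sqrt (2 * ‖z‖ ^ 2 + 1) / 2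

/-- `B(z) = 4 / (2|z|² + 1)^{3/2}`. -/
def B (z : ℂ) : ℝ := 4 / (2 * ‖z‖ ^ 2 + 1) ^ (3 / 2 : ℝ)

/-- The endpoint `e^{iπ/4} / √2` of the spectral segment. -/
def endpoint : ℂ := Complex.exp (Complex.I * (Real.pi / 4)) / Real.sqrt 2

/-- The normal at `ζ` to a segment with direction `e^{iπ/4}`: the line through `ζ` with
direction `e^{3πi/4}`. -/
def normalLine (ζ : ℂ) : Set ℂ :=
  {z | ∃ t : ℝ, z = ζ + t * Complex.exp (Complex.I * (3 * Real.pi / 4))}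

end TruncatedFourier

end

/-! Write `T` for the truncated Fourier operator and `R` for its resolvent at `z`. Two relations
carry the whole proof. First, `T†T + TT† = 1`: the adjoint returns the reflected negative half of
the Fourier transform, so this is Plancherel's identity split over the two half-lines. Second, `T² =
iC`, where `C` is the Carleman operator with kernel `1 / (2π(t + s))`. It is positive because `1/(t
+ s) = ∫ e^{-(t+s)ξ} dξ` over `ξ > 0`, and the first relation forces `C ≤ 1/2`. These relations are
bundled in `IsHalfUnitary`.

Upper bound. Since `(z + T)(z - T) = z² - iC`, the norm of `R` is at most `‖z + T‖` divided by the
distance `c` from `z²` to `i[0, 1/2]`. The identity `gram_add` gives `‖z + T‖² ≤ S = 2|z|² + 1`,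
hence the bound `2A(z)/c`.

Lower bound. With `N = z + T` and `D = z² - iC`, the same identity yields `(N†N)² = S N†N - DD†`,
while `N† = R†D†`; this is `norm_sq_sub_le`. It is tested on joint approximate eigenvectors of `C`
(eigenvalue `l`) and `T†T` (eigenvalue `p > 1/2`). The two relations give `(T†T)² = T†T - C²`, so
`p(1 - p) = l²`. On such vectors `T u` is nearly orthogonal to `u` and `‖N u‖²` is close to `|z|² +
p ≥ S/2`.

The lower bound needs every `l` in `(0, 1/2)` to be an approximate eigenvalue of `C`. As `C`
commutes with dilations, `t^{-1/2+iμ}` is a generalized eigenfunction. Its eigenvalue is continuous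
in `μ`, equals `1/2` at `μ = 0` and tends to `0` at infinity, so it takes all these values. In
coordinates `z = (r + it)e^{iπ/4}`, the distance from `z²` to `il` becomes explicit and gives the
stated constants. -/

noncomputable section

namespace TruncatedFourier

open scoped InnerProductSpace ComplexConjugate

/-! ### Operator identities and invertibility of `z - T` -/

section Abstract

variable {H : Type*} [NormedAddCommGroup H] [InnerProductSpace ℂ H]

lemma inner_self_ofReal (x : H) : ⟪x, x⟫_ℂ = ((‖x‖ ^ 2 : ℝ) : ℂ) := by
  rw [inner_self_eq_norm_sq_to_K]; simp

lemma algebraMap_clm_apply (z : ℂ) (x : H) : algebraMap ℂ (H →L[ℂ] H) z x = z • x := by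
  simp [Algebra.algebraMap_eq_smul_one]

variable [CompleteSpace H]

lemma inner_star_mul_self (L : H →L[ℂ] H) (x : H) :
    ⟪x, (star L * L) x⟫_ℂ = ((‖L x‖ ^ 2 : ℝ) : ℂ) := by
  rw [mul_apply_eq_comp, ContinuousLinearMap.star_eq_adjoint,
    ContinuousLinearMap.adjoint_inner_right, inner_self_eq_norm_sq_to_K]
  simp

lemma inner_mul_star_self (L : H →L[ℂ] H) (x : H) :
    ⟪x, (L * star L) x⟫_ℂ = ((‖star L x‖ ^ 2 : ℝ) : ℂ) := by
  simpa using inner_star_mul_self (star L) x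

/-- A bounded operator `T` with `T†T + TT† = 1` whose square is `i` times a positive operator. -/
structure IsHalfUnitary (T C : H →L[ℂ] H) : Prop where
  add_eq_one : star T * T + T * star T = 1
  sq_eq : T * T = Complex.I • C
  pos : C.IsPositive

namespace IsHalfUnitary

variable {T C : H →L[ℂ] H} (h : IsHalfUnitary T C)

include h

lemma star_C : star C = C := h.pos.isSelfAdjoint

lemma C_eq : C = (-Complex.I) • (T * T) := by
  rw [h.sq_eq, smul_smul]; simp

lemma C_mul : C * T = T * C := by
  rw [h.C_eq]; simp [mul_assoc]

lemma C_mul_star : C * star T = star T * C := by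
  have := congrArg star h.C_mul
  simpa [h.star_C] using this.symm

lemma star_sq_eq : star T * star T = (-Complex.I) • C := by
  have := congrArg star h.sq_eq
  simpa [h.star_C] using this

/-- The product `(T†T)(TT†) = T†(T²)T†` collapses to `C²` because `C` commutes with `T†`;
substituting `TT† = 1 - T†T` gives a quadratic equation for `T†T`. -/
lemma gram_sq : (star T * T) * (star T * T) = star T * T - C * C := by
  have h1 : T * star T = 1 - star T * T := by rw [← h.add_eq_one]; abel
  have h2 : (star T * T) * (T * star T) = C * C := by
    calc (star T * T) * (T * star T) = star T * (T * T) * star T := by simp only [mul_assoc]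
      _ = Complex.I • (star T * C * star T) := by rw [h.sq_eq]; simp
      _ = Complex.I • (C * (star T * star T)) := by rw [← h.C_mul_star]; simp only [mul_assoc]
      _ = C * C := by rw [h.star_sq_eq]; simp [smul_smul]
  rw [h1, mul_sub, mul_one] at h2
  rw [← h2]; abel

lemma norm_sq_add (x : H) : ‖T x‖ ^ 2 + ‖star T x‖ ^ 2 = ‖x‖ ^ 2 := by
  have := congrArg (fun L : H →L[ℂ] H => ⟪x, L x⟫_ℂ) h.add_eq_one
  simp only [add_apply, inner_add_right, inner_star_mul_self, inner_mul_star_self,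
    one_apply_eq_self, inner_self_ofReal] at this
  exact_mod_cast this

lemma norm_apply_le (x : H) : ‖T x‖ ≤ ‖x‖ := by
  have := h.norm_sq_add x
  exact le_of_sq_le_sq (by nlinarith [sq_nonneg ‖star T x‖]) (norm_nonneg _)

lemma norm_star_apply_le (x : H) : ‖star T x‖ ≤ ‖x‖ := by
  have := h.norm_sq_add x
  exact le_of_sq_le_sq (by nlinarith [sq_nonneg ‖T x‖]) (norm_nonneg _)

lemma C_apply (x : H) : C x = (-Complex.I) • T (T x) := by
  conv_lhs => rw [h.C_eq]
  rfl

lemma T_T_apply (x : H) : T (T x) = Complex.I • C x := by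
  rw [h.C_apply, smul_smul]; simp

/-- The quadratic form of `C` is real. -/
lemma inner_C (x : H) : ∃ c : ℝ, ⟪x, C x⟫_ℂ = c ∧ 0 ≤ c ∧ c ≤ ‖x‖ ^ 2 / 2 := by
  have hp := h.pos.inner_nonneg_right x
  obtain ⟨c, hc⟩ : ∃ c : ℝ, ⟪x, C x⟫_ℂ = c :=
    ⟨_, Complex.ext rfl (by simpa using (Complex.le_def.1 hp).2.symm)⟩
  have hc0 : 0 ≤ c := by
    rw [hc] at hp; exact_mod_cast hp
  refine ⟨c, hc, hc0, ?_⟩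
  -- The form of `C` is `-i⟪T†x, T x⟫`, and the squares of the two norms sum to `‖x‖²`; the
  -- arithmetic-geometric mean inequality yields the factor `1/2`.
  have h1 : ‖⟪x, C x⟫_ℂ‖ ≤ ‖star T x‖ * ‖T x‖ := by
    rw [h.C_apply, inner_smul_right, norm_mul, norm_neg, Complex.norm_I, one_mul,
      ← ContinuousLinearMap.adjoint_inner_left]
    exact norm_inner_le_norm _ _
  rw [hc, Complex.norm_real, Real.norm_of_nonneg hc0] at h1
  nlinarith [h.norm_sq_add x, sq_nonneg (‖star T x‖ - ‖T x‖)]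

/-- `z - T` is invertible if the numerical range of `z² - T²` stays away from zero. -/
lemma isUnit_sub {z : ℂ} {c : ℝ} (hc : 0 < c)
    (hz : ∀ l : ℝ, 0 ≤ l → l ≤ 1 / 2 → c ≤ ‖z ^ 2 - Complex.I * l‖) :
    IsUnit (algebraMap ℂ (H →L[ℂ] H) z - T) ∧
      ∀ x, c * ‖x‖ ≤ ‖(algebraMap ℂ (H →L[ℂ] H) z + T) ((algebraMap ℂ (H →L[ℂ] H) z - T) x)‖ := by
  set N := algebraMap ℂ (H →L[ℂ] H) z + T with hN
  set N' := algebraMap ℂ (H →L[ℂ] H) z - T with hN'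
  have hDx : ∀ x, (N * N') x = z ^ 2 • x - Complex.I • C x := by
    intro x
    rw [← h.T_T_apply]
    simp [hN, hN', Algebra.algebraMap_eq_smul_one, smul_sub, smul_smul, pow_two]
  have hform : ∀ x, c * ‖x‖ ^ 2 ≤ ‖⟪x, (N * N') x⟫_ℂ‖ := by
    intro x
    obtain ⟨l, hl, hl0, hl1⟩ := h.inner_C x
    rcases eq_or_ne x 0 with rfl | hx
    · simp
    have hx' : 0 < ‖x‖ ^ 2 := by positivity
    -- After normalization, the form takes the value `z² - il` with `l` in the numerical range of
    -- `C`, hence in `[0, 1/2]`.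
    have h2 : ⟪x, (N * N') x⟫_ℂ = (‖x‖ ^ 2 : ℝ) * (z ^ 2 - Complex.I * (l / ‖x‖ ^ 2 : ℝ)) := by
      rw [hDx, inner_sub_right, inner_smul_right, inner_smul_right, hl, inner_self_eq_norm_sq_to_K]
      have : (‖x‖ : ℂ) ≠ 0 := by exact_mod_cast (norm_pos_iff.2 hx).ne'
      push_cast
      simp only [Complex.coe_algebraMap]
      field_simp
    rw [h2, norm_mul, Complex.norm_real, Real.norm_of_nonneg hx'.le, mul_comm]
    gcongr
    exact hz _ (by positivity) (by rw [div_le_iff₀ hx']; linarith)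
  have hcomm : Commute N' N := by
    have : Commute (algebraMap ℂ (H →L[ℂ] H) z) T := Algebra.commutes z T
    exact ((Commute.refl _).sub_left this.symm).add_right (this.sub_left (Commute.refl _))
  constructor
  · have hu : IsUnit (N * N') := by
      refine ContinuousLinearMap.isUnit_of_forall_le_norm_inner_map _ (c := ⟨c, hc.le⟩) hc ?_
      intro x
      rw [norm_inner_symm, mul_comm]
      exact hform x
    rw [← hcomm.eq] at hu
    exact (hcomm.isUnit_mul_iff.1 hu).1
  · intro x
    rcases eq_or_ne x 0 with rfl | hx
    · simp
    have := (hform x).trans (norm_inner_le_norm _ _)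
    rw [pow_two, ← mul_assoc, mul_comm ‖x‖] at this
    exact le_of_mul_le_mul_right this (norm_pos_iff.2 hx)

/-- The parallelogram-type identity for `z + T` and `z - T`. -/
lemma gram_add (z : ℂ) :
    star (algebraMap ℂ (H →L[ℂ] H) z + T) * (algebraMap ℂ (H →L[ℂ] H) z + T) +
      (algebraMap ℂ (H →L[ℂ] H) z - T) * star (algebraMap ℂ (H →L[ℂ] H) z - T) =
      algebraMap ℂ (H →L[ℂ] H) ((2 * ‖z‖ ^ 2 + 1 : ℝ) : ℂ) := by
  have h1 : ((2 * ‖z‖ ^ 2 + 1 : ℝ) : ℂ) = 2 * (conj z * z) + 1 := by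
    rw [Complex.conj_mul']; push_cast; ring
  -- With the unit written as `T†T + TT†`, the cross terms of the two products cancel each other.
  rw [h1, map_add, map_one, ← h.add_eq_one]
  simp only [Algebra.algebraMap_eq_smul_one, star_add, star_sub, star_smul, star_one, add_mul,
    mul_add, sub_mul, mul_sub, smul_mul_assoc, mul_smul_comm, one_mul, mul_one,
    Complex.star_def]
  module

lemma norm_add_apply_sq_le (z : ℂ) (x : H) :
    ‖(algebraMap ℂ (H →L[ℂ] H) z + T) x‖ ^ 2 ≤ (2 * ‖z‖ ^ 2 + 1) * ‖x‖ ^ 2 := by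
  have := congrArg (fun L : H →L[ℂ] H => ⟪x, L x⟫_ℂ) (h.gram_add z)
  rw [add_apply, inner_add_right, inner_star_mul_self, inner_mul_star_self, algebraMap_clm_apply,
    inner_smul_right, inner_self_ofReal] at this
  have h2 : ‖(algebraMap ℂ (H →L[ℂ] H) z + T) x‖ ^ 2 +
      ‖star (algebraMap ℂ (H →L[ℂ] H) z - T) x‖ ^ 2 = (2 * ‖z‖ ^ 2 + 1) * ‖x‖ ^ 2 := by
    exact_mod_cast this
  linarith [sq_nonneg ‖star (algebraMap ℂ (H →L[ℂ] H) z - T) x‖]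

/-- The identity `‖N†N x‖² = S ‖N x‖² - ‖D† x‖²`, `N = z + T`, `D = z² - T²`, combined with
`N = D (z - T)⁻¹`. -/
lemma norm_sq_sub_le (z : ℂ) (hz : IsUnit (algebraMap ℂ (H →L[ℂ] H) z - T)) (x : H) :
    (2 * ‖z‖ ^ 2 + 1) * ‖(algebraMap ℂ (H →L[ℂ] H) z + T) x‖ ^ 2
        - ‖conj z ^ 2 • x + Complex.I • C x‖ ^ 2
      ≤ ‖resolvent T z‖ ^ 2 *
        ‖(algebraMap ℂ (H →L[ℂ] H) z + T) (conj z ^ 2 • x + Complex.I • C x)‖ ^ 2 := by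
  have hgram := h.gram_add z
  have hR : (algebraMap ℂ (H →L[ℂ] H) z - T) * resolvent T z = 1 :=
    Ring.mul_inverse_cancel _ hz
  have hcomm : (algebraMap ℂ (H →L[ℂ] H) z - T) * (algebraMap ℂ (H →L[ℂ] H) z + T) =
      (algebraMap ℂ (H →L[ℂ] H) z + T) * (algebraMap ℂ (H →L[ℂ] H) z - T) := by
    have := Algebra.commutes z T
    simp only [sub_mul, mul_add, add_mul, mul_sub, this]
    abel
  have hD : (algebraMap ℂ (H →L[ℂ] H) z - T) * (algebraMap ℂ (H →L[ℂ] H) z + T) =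
      z ^ 2 • 1 - Complex.I • C := by
    rw [← h.sq_eq]
    simp only [Algebra.algebraMap_eq_smul_one, sub_mul, mul_add, smul_mul_assoc, mul_smul_comm,
      one_mul, mul_one]
    module
  have hCN : C * (algebraMap ℂ (H →L[ℂ] H) z + T) = (algebraMap ℂ (H →L[ℂ] H) z + T) * C := by
    rw [mul_add, add_mul, h.C_mul, Algebra.commutes z C]
  set N := algebraMap ℂ (H →L[ℂ] H) z + T
  set N' := algebraMap ℂ (H →L[ℂ] H) z - T
  clear_value N N'
  set D : H →L[ℂ] H := z ^ 2 • 1 - Complex.I • C with hDdef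
  have hsD : star D = conj z ^ 2 • 1 + Complex.I • C := by
    simp [hDdef, h.star_C]
  have hsDx : star D x = conj z ^ 2 • x + Complex.I • C x := by rw [hsD]; simp
  have hDN : star D * N = N * star D := by
    rw [hsD, add_mul, mul_add, smul_mul_assoc, smul_mul_assoc, hCN, mul_smul_comm, mul_smul_comm,
      one_mul, mul_one]
  have hND : star N * D = D * star N := by
    have := congrArg star hDN
    simpa using this
  have hprod : (star N * N) * (N' * star N') = D * star D := by
    calc (star N * N) * (N' * star N') = star N * (N * N') * star N' := by simp only [mul_assoc]
      _ = D * (star N * star N') := by rw [← hcomm, hD, hND, mul_assoc]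
      _ = D * star D := by rw [← star_mul, hD]
  -- With `G = N†N` and `S = 2|z|² + 1`, `gram_add` turns `hprod` into `G(S - G) = DD†`.
  have hG : star (star N * N) * (star N * N) =
      ((2 * ‖z‖ ^ 2 + 1 : ℝ) : ℂ) • (star N * N) - D * star D := by
    have hS : ((2 * ‖z‖ ^ 2 + 1 : ℝ) : ℂ) • (star N * N) =
        (star N * N) * (star N * N + N' * star N') := by
      rw [hgram, Algebra.algebraMap_eq_smul_one, mul_smul_comm, mul_one]
    rw [star_mul, star_star, ← hprod, hS, mul_add, add_sub_cancel_right]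
  have hNR : star N = star (resolvent T z) * star D := by
    rw [← star_mul, ← hD, hcomm, mul_assoc, hR, mul_one]
  have h1 : ‖(star N * N) x‖ ^ 2 = (2 * ‖z‖ ^ 2 + 1) * ‖N x‖ ^ 2 - ‖star D x‖ ^ 2 := by
    have := congrArg (fun L : H →L[ℂ] H => ⟪x, L x⟫_ℂ) hG
    rw [inner_star_mul_self, sub_apply, inner_sub_right, inner_mul_star_self, smul_apply,
      inner_smul_right, inner_star_mul_self] at this
    exact_mod_cast this
  have h2 : (star N * N) x = star (resolvent T z) (N (star D x)) := by
    rw [hNR, mul_assoc, hDN]; rfl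
  rw [← hsDx, ← h1, h2, ← mul_pow]
  gcongr
  simpa using (star (resolvent T z)).le_opNorm (N (star D x))

end IsHalfUnitary

end Abstract

/-! ### Joint approximate eigenvectors and the lower bound -/

section LowerBound

variable {H : Type*} [NormedAddCommGroup H] [InnerProductSpace ℂ H]

lemma norm_inv_norm_smul {u : H} (hu : 0 < ‖u‖) : ‖((‖u‖⁻¹ : ℝ) : ℂ) • u‖ = 1 := by
  rw [norm_smul, Complex.norm_real, norm_inv, norm_norm, inv_mul_cancel₀ hu.ne']

lemma norm_apply_inv_norm_smul_sub_le (L : H →L[ℂ] H) (l : ℂ) {u : H} {ε : ℝ} (hu : 0 < ‖u‖)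
    (hL : ‖L u - l • u‖ ≤ ‖u‖ * ε) :
    ‖L (((‖u‖⁻¹ : ℝ) : ℂ) • u) - l • ((‖u‖⁻¹ : ℝ) : ℂ) • u‖ ≤ ε := by
  rw [map_smul, smul_comm, ← smul_sub, norm_smul, Complex.norm_real, norm_inv, norm_norm,
    inv_mul_le_iff₀ hu]
  exact hL

variable [CompleteSpace H]

lemma inner_gram (T : H →L[ℂ] H) (x y : H) : ⟪x, star T (T y)⟫_ℂ = ⟪T x, T y⟫_ℂ := by
  rw [ContinuousLinearMap.star_eq_adjoint, ContinuousLinearMap.adjoint_inner_right]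

namespace IsHalfUnitary

variable {T C : H →L[ℂ] H} (h : IsHalfUnitary T C)

include h

lemma norm_C_apply_le (x : H) : ‖C x‖ ≤ ‖x‖ := by
  rw [h.C_apply, norm_smul, norm_neg, Complex.norm_I, one_mul]
  exact (h.norm_apply_le _).trans (h.norm_apply_le _)

lemma C_star_apply (x : H) : C (star T x) = star T (C x) :=
  congrArg (fun L : H →L[ℂ] H => L x) h.C_mul_star

lemma C_T_apply (x : H) : C (T x) = T (C x) :=
  congrArg (fun L : H →L[ℂ] H => L x) h.C_mul

lemma gram_gram_apply (x : H) :
    star T (T (star T (T x))) = star T (T x) - C (C x) :=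
  congrArg (fun L : H →L[ℂ] H => L x) h.gram_sq

/-- Approximate eigenvectors of `C` can be chosen with `‖T x‖² ≥ ‖x‖² / 2`. -/
lemma exists_approx_half {l : ℝ}
    (happ : ∀ ε > 0, ∃ x, ‖x‖ = 1 ∧ ‖C x - (l : ℂ) • x‖ ≤ ε) :
    ∀ ε > 0, ∃ x, ‖x‖ = 1 ∧ ‖C x - (l : ℂ) • x‖ ≤ ε ∧ 1 / 2 ≤ ‖T x‖ ^ 2 := by
  intro ε hε
  obtain ⟨x, hx1, hx2⟩ := happ (ε / 2) (by positivity)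
  by_cases hc : 1 / 2 ≤ ‖T x‖ ^ 2
  · exact ⟨x, hx1, by linarith, hc⟩
  have hsum := h.norm_sq_add x
  rw [hx1] at hsum
  -- If `T x` is too short, then `T†x` is long, and `T†` preserves approximate eigenvectors of `C`.
  set y := star T x with hy
  have hy2 : 1 / 2 ≤ ‖y‖ ^ 2 := by linarith
  have hy0 : 0 < ‖y‖ := by
    by_contra hcon
    have : ‖y‖ = 0 := le_antisymm (not_lt.1 hcon) (norm_nonneg _)
    rw [this] at hy2; norm_num at hy2
  have hyh : 1 / 2 ≤ ‖y‖ := by nlinarith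
  have hCy : ‖C y - (l : ℂ) • y‖ ≤ ε / 2 := by
    have : C y - (l : ℂ) • y = star T (C x - (l : ℂ) • x) := by
      rw [hy, h.C_star_apply, map_sub, map_smul]
    rw [this]
    exact (h.norm_star_apply_le _).trans hx2
  -- Pairing `T y` with the unit vector `x` returns `‖T†x‖²`, so the ratio `‖T y‖² / ‖y‖²` is at
  -- least `‖y‖² ≥ 1/2`.
  have hTy : ‖y‖ ^ 2 ≤ ‖T y‖ := by
    have h1 : ‖⟪T y, x⟫_ℂ‖ = ‖y‖ ^ 2 := by
      rw [← ContinuousLinearMap.adjoint_inner_right, ← ContinuousLinearMap.star_eq_adjoint, ← hy,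
        inner_self_ofReal, Complex.norm_real, Real.norm_of_nonneg (by positivity)]
    rw [← h1]
    simpa [hx1] using norm_inner_le_norm (𝕜 := ℂ) (T y) x
  refine ⟨((‖y‖⁻¹ : ℝ) : ℂ) • y, ?_, ?_, ?_⟩
  · exact norm_inv_norm_smul hy0
  · exact norm_apply_inv_norm_smul_sub_le C l hy0 (hCy.trans (by nlinarith))
  · rw [map_smul, norm_smul, Complex.norm_real, norm_inv, norm_norm, mul_pow, inv_pow,
      le_inv_mul_iff₀ (by positivity)]
    nlinarith [norm_nonneg (T y), sq_nonneg ‖y‖]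

/-- Joint approximate eigenvectors of `C` and `T†T`. -/
lemma exists_approx_gram {l p : ℝ} (hl : 0 < l) (hl2 : l < 1 / 2) (hp : 1 / 2 < p)
    (hp1 : p ≤ 1) (hlp : p * (1 - p) = l ^ 2)
    (happ : ∀ ε > 0, ∃ x, ‖x‖ = 1 ∧ ‖C x - (l : ℂ) • x‖ ≤ ε) :
    ∀ ε > 0, ∃ u, ‖u‖ = 1 ∧ ‖C u - (l : ℂ) • u‖ ≤ ε ∧ ‖star T (T u) - (p : ℂ) • u‖ ≤ ε := by
  intro ε hε
  have hc : 0 < 2 * p - 1 := by linarith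
  obtain ⟨x, hx1, hx2, hx3⟩ := h.exists_approx_half happ
    (min ((2 * p - 1) ^ 2 / 8) (ε * ((2 * p - 1) / 2) / 2)) (by positivity)
  set η := ‖C x - (l : ℂ) • x‖ with hη
  have hη0 : 0 ≤ η := norm_nonneg _
  have hη1 : η ≤ (2 * p - 1) ^ 2 / 8 := hx2.trans (min_le_left _ _)
  have hη2 : η ≤ ε * ((2 * p - 1) / 2) / 2 := hx2.trans (min_le_right _ _)
  -- Approximate spectral projection: the quadratic equation has roots `p` and `1 - p`, and `T†T -
  -- (1 - p)` removes the component at the unwanted root.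
  set u := star T (T x) - ((1 - p : ℝ) : ℂ) • x with hu
  have hCx : ‖C x‖ ≤ l + η := by
    have := norm_sub_norm_le (C x) ((l : ℂ) • x)
    rw [norm_smul, hx1, mul_one, Complex.norm_real, Real.norm_of_nonneg hl.le] at this
    linarith
  have hgram : ‖star T (T x)‖ ^ 2 = ‖T x‖ ^ 2 - ‖C x‖ ^ 2 := by
    have h1 : ⟪x, star T (T (star T (T x)))⟫_ℂ = ((‖star T (T x)‖ ^ 2 : ℝ) : ℂ) := by
      rw [inner_gram, ← inner_conj_symm, ← inner_gram, inner_self_ofReal, Complex.conj_ofReal]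
    have h2 : ⟪x, C (C x)⟫_ℂ = ((‖C x‖ ^ 2 : ℝ) : ℂ) := by
      rw [← h.pos.inner_left_eq_inner_right, inner_self_ofReal]
    rw [h.gram_gram_apply, inner_sub_right, inner_gram, h2, inner_self_ofReal] at h1
    exact_mod_cast h1.symm
  have hu2 : ‖u‖ ^ 2 = (2 * p - 1) * ‖T x‖ ^ 2 - ‖C x‖ ^ 2 + (1 - p) ^ 2 := by
    rw [hu, @norm_sub_sq ℂ, hgram, inner_smul_right, ← inner_conj_symm, inner_gram,
      inner_self_ofReal, Complex.conj_ofReal, ← Complex.ofReal_mul, norm_smul, hx1,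
      Complex.norm_real, mul_one, Real.norm_eq_abs, sq_abs]
    simp only [RCLike.re_to_complex, Complex.ofReal_re]
    ring
  -- For `η = 0`, the bound `‖T x‖² ≥ 1/2` and `l² = p(1 - p)` give `‖u‖² ≥ (2p - 1)²/2`; the choice
  -- of `η` costs at most half of this.
  have hu3 : ((2 * p - 1) / 2) ^ 2 ≤ ‖u‖ ^ 2 := by
    have h3 : ‖C x‖ ^ 2 ≤ (l + η) ^ 2 := by gcongr
    nlinarith
  have hu4 : (2 * p - 1) / 2 ≤ ‖u‖ := le_of_sq_le_sq hu3 (norm_nonneg _)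
  have hu0 : 0 < ‖u‖ := lt_of_lt_of_le (by positivity) hu4
  have hCu : ‖C u - (l : ℂ) • u‖ ≤ 2 * η := by
    have : C u - (l : ℂ) • u = star T (T (C x - (l : ℂ) • x))
        - ((1 - p : ℝ) : ℂ) • (C x - (l : ℂ) • x) := by
      rw [hu, map_sub, map_smul, h.C_star_apply, h.C_T_apply, map_sub, map_sub, map_smul, map_smul]
      module
    rw [this]
    refine (norm_sub_le _ _).trans ?_
    rw [norm_smul, Complex.norm_real, Real.norm_of_nonneg (by linarith), ← hη]
    have := (h.norm_star_apply_le _).trans (h.norm_apply_le (C x - (l : ℂ) • x))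
    nlinarith
  have hPu : ‖star T (T u) - (p : ℂ) • u‖ ≤ 2 * η := by
    -- This is `(T†T - p)(T†T - (1 - p)) = -(C² - l²) = -(C + l)(C - l)`, applied to `x`.
    have : star T (T u) - (p : ℂ) • u =
        -(C (C x - (l : ℂ) • x) + (l : ℂ) • (C x - (l : ℂ) • x)) := by
      have hlp' : ((p : ℂ) * (1 - p)) = (l : ℂ) * l := by
        rw [← pow_two]; exact_mod_cast hlp
      rw [hu, map_sub, map_smul, map_sub, map_smul, h.gram_gram_apply, map_sub, map_smul,
        smul_sub, smul_sub, smul_smul, smul_smul]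
      push_cast
      rw [hlp']
      module
    rw [this, norm_neg]
    refine (norm_add_le _ _).trans ?_
    rw [norm_smul, Complex.norm_real, Real.norm_of_nonneg hl.le, ← hη]
    have := h.norm_C_apply_le (C x - (l : ℂ) • x)
    nlinarith
  clear_value u η
  have hfin : 2 * η ≤ ‖u‖ * ε := by nlinarith
  refine ⟨((‖u‖⁻¹ : ℝ) : ℂ) • u, ?_, ?_, ?_⟩
  · exact norm_inv_norm_smul hu0
  · exact norm_apply_inv_norm_smul_sub_le C l hu0 (hCu.trans hfin)
  · exact norm_apply_inv_norm_smul_sub_le (star T * T) p hu0 (hPu.trans hfin)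

/-- For joint approximate eigenvectors, `T u` is almost orthogonal to `u`. -/
lemma norm_inner_T_le {l p ε : ℝ} (hl : 0 < l) (hlp : l < p) {u : H} (hu : ‖u‖ = 1)
    (hC : ‖C u - (l : ℂ) • u‖ ≤ ε) (hP : ‖star T (T u) - (p : ℂ) • u‖ ≤ ε) :
    ‖⟪u, T u⟫_ℂ‖ ≤ 2 * ε / (p - l) := by
  have hTu : ‖T u‖ ≤ 1 := hu ▸ h.norm_apply_le u
  -- Evaluating `⟪T†T u, T u⟫ = ⟪T u, T²u⟫` in two ways compares `p⟪u, T u⟫` with `il⟪T u, u⟫`. The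
  -- two inner products have equal modulus and `l < p`, so both must be small.
  have h1 : (p : ℂ) * ⟪u, T u⟫_ℂ = Complex.I * l * ⟪T u, u⟫_ℂ
      + Complex.I * ⟪T u, C u - (l : ℂ) • u⟫_ℂ - ⟪star T (T u) - (p : ℂ) • u, T u⟫_ℂ := by
    have h2 : ⟪star T (T u), T u⟫_ℂ = Complex.I * ⟪T u, C u⟫_ℂ := by
      rw [← inner_conj_symm, inner_gram, inner_conj_symm, h.T_T_apply, inner_smul_right]
    rw [inner_sub_left, inner_sub_right, h2, inner_smul_left, inner_smul_right, Complex.conj_ofReal]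
    ring
  have h3 : p * ‖⟪u, T u⟫_ℂ‖ ≤ l * ‖⟪u, T u⟫_ℂ‖ + ε + ε := by
    calc p * ‖⟪u, T u⟫_ℂ‖ = ‖(p : ℂ) * ⟪u, T u⟫_ℂ‖ := by
          rw [norm_mul, Complex.norm_real, Real.norm_of_nonneg (hl.le.trans hlp.le)]
      _ ≤ ‖Complex.I * l * ⟪T u, u⟫_ℂ‖ + ‖Complex.I * ⟪T u, C u - (l : ℂ) • u⟫_ℂ‖
          + ‖⟪star T (T u) - (p : ℂ) • u, T u⟫_ℂ‖ := by
          rw [h1]; exact (norm_sub_le _ _).trans (by gcongr; exact norm_add_le _ _)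
      _ ≤ _ := by
          have e1 := norm_inner_le_norm (𝕜 := ℂ) (T u) (C u - (l : ℂ) • u)
          have e2 := norm_inner_le_norm (𝕜 := ℂ) (star T (T u) - (p : ℂ) • u) (T u)
          rw [norm_mul, norm_mul, norm_mul, Complex.norm_I, Complex.norm_real,
            Real.norm_of_nonneg hl.le, norm_inner_symm]
          nlinarith [norm_nonneg (T u), norm_nonneg (C u - (l : ℂ) • u),
            norm_nonneg (star T (T u) - (p : ℂ) • u)]
  rw [le_div_iff₀ (by linarith)]
  linarith

/-- The lower bound of the resolvent produced by an approximate eigenvalue of `C`. -/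
lemma le_norm_resolvent_sq_of_mem_Ioo {z : ℂ} {l : ℝ} (hl : 0 < l) (hl2 : l < 1 / 2)
    (hz : IsUnit (algebraMap ℂ (H →L[ℂ] H) z - T))
    (happ : ∀ ε > 0, ∃ x, ‖x‖ = 1 ∧ ‖C x - (l : ℂ) • x‖ ≤ ε) :
    (2 * ‖z‖ ^ 2 + 1) - 2 * ‖z ^ 2 - Complex.I * l‖ ^ 2 / (2 * ‖z‖ ^ 2 + 1)
      ≤ ‖resolvent T z‖ ^ 2 * ‖z ^ 2 - Complex.I * l‖ ^ 2 := by
  -- The larger root of `p(1 - p) = l²`; strictness of `l < 1/2` separates it from both `1/2` and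
  -- `l`.
  obtain ⟨p, hp, hp1, hlp, hltp⟩ : ∃ p : ℝ, 1 / 2 < p ∧ p ≤ 1 ∧ p * (1 - p) = l ^ 2 ∧ l < p := by
    have h0 : 0 < 1 - 4 * l ^ 2 := by nlinarith
    have h1 : √(1 - 4 * l ^ 2) ≤ 1 := Real.sqrt_le_one.2 (by nlinarith)
    have h2 := Real.sqrt_pos.2 h0
    have h3 := Real.sq_sqrt h0.le
    exact ⟨(1 + √(1 - 4 * l ^ 2)) / 2, by linarith, by linarith, by nlinarith, by linarith⟩
  have key := h.exists_approx_gram hl hl2 hp hp1 hlp happ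
  choose u hu1 huC huP using fun n : ℕ => key (1 / ((n : ℝ) + 1)) (by positivity)
  have hε : Tendsto (fun n : ℕ => 1 / ((n : ℝ) + 1)) atTop (𝓝 0) :=
    tendsto_one_div_add_atTop_nhds_zero_nat
  set N := algebraMap ℂ (H →L[ℂ] H) z + T with hN
  set d := ‖z ^ 2 - Complex.I * l‖ with hd
  set S := 2 * ‖z‖ ^ 2 + 1 with hS
  have hS0 : 0 < S := by positivity
  have hC0 : Tendsto (fun n => ‖C (u n) - (l : ℂ) • u n‖) atTop (𝓝 0) :=
    squeeze_zero (fun _ => norm_nonneg _) huC hε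
  have hP0 : Tendsto (fun n => ‖star T (T (u n)) - (p : ℂ) • u n‖) atTop (𝓝 0) :=
    squeeze_zero (fun _ => norm_nonneg _) huP hε
  have hI0 : Tendsto (fun n => ‖⟪u n, T (u n)⟫_ℂ‖) atTop (𝓝 0) := by
    refine squeeze_zero (fun _ => norm_nonneg _)
      (fun n => h.norm_inner_T_le hl hltp (hu1 n) (huC n) (huP n)) ?_
    simpa using (hε.const_mul 2).div_const (p - l)
  have hNu : Tendsto (fun n => ‖N (u n)‖ ^ 2) atTop (𝓝 (‖z‖ ^ 2 + p)) := by
    have e : ∀ n, ‖N (u n)‖ ^ 2 = ‖z‖ ^ 2 + p + 2 * (⟪z • u n, T (u n)⟫_ℂ).re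
        + (⟪u n, star T (T (u n)) - (p : ℂ) • u n⟫_ℂ).re := by
      intro n
      rw [hN, add_apply, algebraMap_clm_apply, @norm_add_sq ℂ, norm_smul, hu1, mul_one,
        inner_sub_right, inner_gram, inner_smul_right, inner_self_ofReal, inner_self_ofReal, hu1]
      simp only [RCLike.re_to_complex, Complex.sub_re, Complex.ofReal_re, one_pow,
        Complex.ofReal_one, mul_one]
      ring
    simp_rw [e]
    have e1 : Tendsto (fun n => 2 * (⟪z • u n, T (u n)⟫_ℂ).re) atTop (𝓝 0) := by
      rw [← mul_zero (2 : ℝ)]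
      refine Tendsto.const_mul 2 (squeeze_zero_norm (fun n => ?_) (by simpa using hI0.const_mul ‖z‖))
      rw [inner_smul_left, Real.norm_eq_abs]
      refine (Complex.abs_re_le_norm _).trans ?_
      rw [norm_mul, RCLike.norm_conj]
    have e2 : Tendsto (fun n => (⟪u n, star T (T (u n)) - (p : ℂ) • u n⟫_ℂ).re) atTop (𝓝 0) := by
      refine squeeze_zero_norm (fun n => ?_) hP0
      rw [Real.norm_eq_abs]
      refine (Complex.abs_re_le_norm _).trans ?_
      refine (norm_inner_le_norm _ _).trans ?_
      rw [hu1, one_mul]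
    simpa using (tendsto_const_nhds.add e1).add e2
  have hNu' : Tendsto (fun n => ‖N (u n)‖) atTop (𝓝 (√(‖z‖ ^ 2 + p))) := by
    simpa [Real.sqrt_sq] using hNu.sqrt
  have hDe : ∀ n, conj z ^ 2 • u n + Complex.I • C (u n)
      = (conj z ^ 2 + Complex.I * l) • u n + Complex.I • (C (u n) - (l : ℂ) • u n) := by
    intro n; module
  have hdc : ‖conj z ^ 2 + Complex.I * l‖ = d := by
    rw [hd, ← RCLike.norm_conj]; simp [sub_eq_add_neg]
  have hDu : Tendsto (fun n => ‖conj z ^ 2 • u n + Complex.I • C (u n)‖) atTop (𝓝 d) := by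
    rw [tendsto_iff_norm_sub_tendsto_zero]
    refine squeeze_zero (fun _ => norm_nonneg _) (fun n => ?_) hC0
    have e1 : d = ‖(conj z ^ 2 + Complex.I * l) • u n‖ := by rw [norm_smul, hu1, mul_one, hdc]
    rw [e1, hDe]
    refine (abs_norm_sub_norm_le _ _).trans ?_
    rw [add_sub_cancel_left, norm_smul, Complex.norm_I, one_mul]
  have hNDu : Tendsto (fun n => ‖N (conj z ^ 2 • u n + Complex.I • C (u n))‖) atTop
      (𝓝 (d * √(‖z‖ ^ 2 + p))) := by
    have e0 : Tendsto (fun n => ‖N (conj z ^ 2 • u n + Complex.I • C (u n))‖ - d * ‖N (u n)‖) atTop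
        (𝓝 0) := by
      refine squeeze_zero_norm (fun n => ?_) (by simpa only [mul_zero] using hC0.const_mul ‖N‖)
      have e1 : d * ‖N (u n)‖ = ‖(conj z ^ 2 + Complex.I * l) • N (u n)‖ := by rw [norm_smul, hdc]
      rw [e1, hDe, map_add, map_smul]
      refine (abs_norm_sub_norm_le _ _).trans ?_
      rw [add_sub_cancel_left]
      refine (N.le_opNorm _).trans ?_
      rw [norm_smul, Complex.norm_I, one_mul]
    simpa using e0.add (hNu'.const_mul d)
  have hlim := le_of_tendsto_of_tendsto' ((hNu.const_mul S).sub (hDu.pow 2))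
    ((hNDu.pow 2).const_mul (‖resolvent T z‖ ^ 2)) (fun n => h.norm_sq_sub_le z hz (u n))
  rw [mul_pow, Real.sq_sqrt (by positivity)] at hlim
  -- The limit inequality is `S n - d² ≤ ‖R‖² d² n` with `n = |z|² + p`; dividing by `n ≥ S/2` gives
  -- the error `2d²/S`.
  have hhalf : S / 2 ≤ ‖z‖ ^ 2 + p := by rw [hS]; linarith
  by_contra! hcon
  have h1 : 2 * d ^ 2 / S < S - ‖resolvent T z‖ ^ 2 * d ^ 2 := by linarith
  rw [div_lt_iff₀ hS0] at h1
  have h2 : 0 ≤ S - ‖resolvent T z‖ ^ 2 * d ^ 2 := by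
    by_contra! h3
    nlinarith [sq_nonneg d]
  nlinarith

end IsHalfUnitary

end LowerBound

/-! ### Coordinates along the segment and its normals -/

section Geometry

/-- The point with coordinates `(r, t)` along the segment and along its normal. -/
def rotated (r t : ℝ) : ℂ := (r + t * Complex.I) * Complex.exp (Complex.I * (Real.pi / 4))

lemma exp_pi_div_four_sq : Complex.exp (Complex.I * (Real.pi / 4)) ^ 2 = Complex.I := by
  rw [← Complex.exp_nat_mul]
  convert Complex.exp_pi_div_two_mul_I using 2
  push_cast; ring

lemma norm_exp_pi_div_four : ‖Complex.exp (Complex.I * (Real.pi / 4))‖ = 1 := by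
  have := Complex.norm_exp_I_mul_ofReal (Real.pi / 4)
  push_cast at this
  exact this

lemma exp_three_pi_div_four :
    Complex.exp (Complex.I * (3 * Real.pi / 4)) =
      Complex.I * Complex.exp (Complex.I * (Real.pi / 4)) := by
  have := Complex.exp_add (Real.pi / 2 * Complex.I) (Complex.I * (Real.pi / 4))
  rw [Complex.exp_pi_div_two_mul_I] at this
  rw [← this]
  congr 1; ring

lemma norm_rotated_sq (r t : ℝ) : ‖rotated r t‖ ^ 2 = r ^ 2 + t ^ 2 := by
  rw [rotated, norm_mul, norm_exp_pi_div_four, mul_one, Complex.sq_norm, Complex.normSq_add_mul_I]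

lemma norm_rotated_zero_right (r : ℝ) : ‖rotated r 0‖ = |r| := by
  rw [rotated, norm_mul, norm_exp_pi_div_four]; simp

lemma rotated_sub (r t : ℝ) :
    rotated r t - rotated r 0 = t * Complex.exp (Complex.I * (3 * Real.pi / 4)) := by
  rw [exp_three_pi_div_four, rotated, rotated]; push_cast; ring

lemma norm_rotated_sub (r t : ℝ) : ‖rotated r t - rotated r 0‖ = |t| := by
  rw [rotated_sub, exp_three_pi_div_four, norm_mul, norm_mul, norm_exp_pi_div_four]; simp

/-- Since `(e^{iπ/4})² = i`, the square of the rotated point is `i(r + it)²`; subtracting `il`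
changes only the real part inside the bracket. -/
lemma norm_rotated_sq_sub (r t l : ℝ) :
    ‖rotated r t ^ 2 - Complex.I * l‖ ^ 2 = 4 * r ^ 2 * t ^ 2 + (r ^ 2 - t ^ 2 - l) ^ 2 := by
  have : rotated r t ^ 2 - Complex.I * l =
      ((-2 * r * t : ℝ) : ℂ) + ((r ^ 2 - t ^ 2 - l : ℝ) : ℂ) * Complex.I := by
    rw [rotated, mul_pow, exp_pi_div_four_sq]
    push_cast
    linear_combination (2 * r * t + t ^ 2 * Complex.I : ℂ) * Complex.I_sq
  rw [this, Complex.sq_norm, Complex.normSq_add_mul_I]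
  ring

lemma exists_eq_rotated (z : ℂ) : ∃ r t : ℝ, z = rotated r t := by
  refine ⟨(z * (Complex.exp (Complex.I * (Real.pi / 4)))⁻¹).re,
    (z * (Complex.exp (Complex.I * (Real.pi / 4)))⁻¹).im, ?_⟩
  rw [rotated, Complex.re_add_im, mul_assoc, inv_mul_cancel₀ (Complex.exp_ne_zero _), mul_one]

lemma mem_normalLine_rotated {r : ℝ} {z : ℂ} :
    z ∈ normalLine (rotated r 0) ↔ ∃ t : ℝ, z = rotated r t := by
  have e : ∀ t : ℝ, rotated r 0 + t * Complex.exp (Complex.I * (3 * Real.pi / 4)) = rotated r t :=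
    fun t => by rw [← rotated_sub, add_sub_cancel]
  change (∃ t : ℝ, z = rotated r 0 + t * Complex.exp (Complex.I * (3 * Real.pi / 4))) ↔ _
  simp only [e]

lemma rotated_mem_segment {r : ℝ} (hr : r ^ 2 ≤ 1 / 2) :
    rotated r 0 ∈ segment ℝ (-endpoint) endpoint := by
  have h2 : (0 : ℝ) < √2 := by positivity
  have hsq : √2 ^ 2 = 2 := Real.sq_sqrt (by norm_num)
  have hle : |r * √2| ≤ 1 := by
    rw [← sq_le_one_iff_abs_le_one, mul_pow, hsq]; linarith
  obtain ⟨h3, h4⟩ := abs_le.1 hle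
  refine ⟨(1 - r * √2) / 2, (1 + r * √2) / 2, by linarith, by linarith, by ring, ?_⟩
  have h5 : (√2 : ℂ) ≠ 0 := by exact_mod_cast h2.ne'
  simp only [endpoint, rotated, Complex.real_smul]
  push_cast
  field_simp
  ring

lemma exists_of_mem_segment {z : ℂ} (hz : z ∈ segment ℝ (-endpoint) endpoint) :
    ∃ r : ℝ, r ^ 2 ≤ 1 / 2 ∧ z = rotated r 0 := by
  obtain ⟨a, b, ha, hb, hab, rfl⟩ := hz
  have h2 : (0 : ℝ) < √2 := by positivity
  have hsq : √2 ^ 2 = 2 := Real.sq_sqrt (by norm_num)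
  refine ⟨(b - a) / √2, ?_, ?_⟩
  · rw [div_pow, hsq]
    nlinarith
  · have h5 : (√2 : ℂ) ≠ 0 := by exact_mod_cast h2.ne'
    simp only [endpoint, rotated, Complex.real_smul]
    push_cast
    field_simp
    ring

end Geometry

/-! ### Bounds for the constants `A` and `B` -/

lemma A_rotated (r t : ℝ) : A (rotated r t) = √(2 * (r ^ 2 + t ^ 2) + 1) / 2 := by
  rw [A, norm_rotated_sq]

lemma half_le_A (z : ℂ) : 1 / 2 ≤ A z := by
  rw [A]
  gcongr
  exact Real.one_le_sqrt.2 (by nlinarith [sq_nonneg ‖z‖])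

lemma B_nonneg (z : ℂ) : 0 ≤ B z := by
  rw [B]; positivity

lemma B_le (z : ℂ) : B z ≤ 4 := by
  rw [B]
  refine div_le_self (by norm_num) (Real.one_le_rpow (by nlinarith [sq_nonneg ‖z‖]) (by norm_num))

/-- The difference is quadratic in `t`, so replacing `A(z)` by `A(ζ)` changes the leading term by a
bounded quantity only. -/
lemma A_rotated_sub_le (r t : ℝ) :
    0 ≤ A (rotated r t) - A (rotated r 0) ∧ A (rotated r t) - A (rotated r 0) ≤ t ^ 2 / 2 := by
  rw [A_rotated, A_rotated]
  have h1 : √(2 * (r ^ 2 + 0 ^ 2) + 1) ≤ √(2 * (r ^ 2 + t ^ 2) + 1) :=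
    Real.sqrt_le_sqrt (by nlinarith [sq_nonneg t])
  have h2 := Real.sq_sqrt (show 0 ≤ 2 * (r ^ 2 + 0 ^ 2) + 1 by positivity)
  have h3 := Real.sq_sqrt (show 0 ≤ 2 * (r ^ 2 + t ^ 2) + 1 by positivity)
  have h4 : 1 ≤ √(2 * (r ^ 2 + 0 ^ 2) + 1) := Real.one_le_sqrt.2 (by nlinarith [sq_nonneg r])
  generalize √(2 * (r ^ 2 + 0 ^ 2) + 1) = a at *
  generalize √(2 * (r ^ 2 + t ^ 2) + 1) = b at *
  constructor
  · linarith
  · nlinarith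

/-! ### Resolvent estimates for an abstract half-unitary operator -/

section Abstract

variable {H : Type*} [NormedAddCommGroup H] [InnerProductSpace ℂ H] [CompleteSpace H]

namespace IsHalfUnitary

variable {T C : H →L[ℂ] H} (h : IsHalfUnitary T C)

include h

lemma norm_resolvent_le {z : ℂ} {c : ℝ} (hc : 0 < c)
    (hz : ∀ l : ℝ, 0 ≤ l → l ≤ 1 / 2 → c ≤ ‖z ^ 2 - Complex.I * l‖) :
    ‖resolvent T z‖ ≤ 2 * A z / c := by
  obtain ⟨hu, hb⟩ := h.isUnit_sub hc hz
  refine ContinuousLinearMap.opNorm_le_bound _ (by have := half_le_A z; positivity) (fun y => ?_)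
  have h1 := hb (resolvent T z y)
  have h2 : (algebraMap ℂ (H →L[ℂ] H) z - T) (resolvent T z y) = y :=
    congrArg (fun L : H →L[ℂ] H => L y) (Ring.mul_inverse_cancel _ hu)
  rw [h2] at h1
  have h3 : ‖(algebraMap ℂ (H →L[ℂ] H) z + T) y‖ ≤ 2 * A z * ‖y‖ := by
    refine le_of_sq_le_sq ((h.norm_add_apply_sq_le z y).trans_eq ?_)
      (by have := half_le_A z; positivity)
    rw [A, mul_div_cancel₀ _ (by norm_num), mul_pow, Real.sq_sqrt (by positivity)]
  rw [div_mul_eq_mul_div, le_div_iff₀ hc, mul_comm]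
  exact h1.trans h3

variable (happ : ∀ l : ℝ, 0 < l → l < 1 / 2 → ∀ ε > 0, ∃ x, ‖x‖ = 1 ∧ ‖C x - (l : ℂ) • x‖ ≤ ε)

include happ

lemma le_norm_resolvent_sq {z : ℂ} {l : ℝ} (hl : 0 ≤ l) (hl2 : l ≤ 1 / 2)
    (hz : IsUnit (algebraMap ℂ (H →L[ℂ] H) z - T)) :
    (2 * ‖z‖ ^ 2 + 1) - 2 * ‖z ^ 2 - Complex.I * l‖ ^ 2 / (2 * ‖z‖ ^ 2 + 1)
      ≤ ‖resolvent T z‖ ^ 2 * ‖z ^ 2 - Complex.I * l‖ ^ 2 := by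
  -- Both sides are continuous in `l`, so the inequality passes to the endpoints `0` and `1/2`,
  -- where the eigenvector construction is unavailable.
  have hclosed : IsClosed {l : ℝ |
      (2 * ‖z‖ ^ 2 + 1) - 2 * ‖z ^ 2 - Complex.I * l‖ ^ 2 / (2 * ‖z‖ ^ 2 + 1)
        ≤ ‖resolvent T z‖ ^ 2 * ‖z ^ 2 - Complex.I * l‖ ^ 2} :=
    isClosed_le (by fun_prop) (by fun_prop)
  have hsub : closure (Ioo (0 : ℝ) (1 / 2)) ⊆ _ := hclosed.closure_subset_iff.2
    fun l hl => h.le_norm_resolvent_sq_of_mem_Ioo hl.1 hl.2 hz (happ l hl.1 hl.2)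
  rw [closure_Ioo (by norm_num)] at hsub
  exact hsub ⟨hl, hl2⟩

lemma le_norm_resolvent {z : ℂ} {l d : ℝ} (hl : 0 ≤ l) (hl2 : l ≤ 1 / 2)
    (hz : IsUnit (algebraMap ℂ (H →L[ℂ] H) z - T)) (hd : 0 < d)
    (hdl : ‖z ^ 2 - Complex.I * l‖ ^ 2 = d ^ 2) :
    2 * A z / d - B z * d / 2 ≤ ‖resolvent T z‖ := by
  have key := h.le_norm_resolvent_sq happ hl hl2 hz
  rw [hdl] at key
  rw [A, B]
  set S := 2 * ‖z‖ ^ 2 + 1 with hS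
  have hS0 : 0 < S := by positivity
  have hs : S ^ (3 / 2 : ℝ) = S * √S := by
    rw [show (3 / 2 : ℝ) = 1 + 1 / 2 by norm_num, Real.rpow_add hS0, Real.rpow_one,
      Real.sqrt_eq_rpow]
  set s := √S with hsdef
  have hs0 : 0 < s := Real.sqrt_pos.2 hS0
  have hss : S = s ^ 2 := (Real.sq_sqrt hS0.le).symm
  have e : 2 * (s / 2) / d - 4 / S ^ (3 / 2 : ℝ) * d / 2 = s * (1 - 2 * d ^ 2 / S ^ 2) / d := by
    rw [hs, hss]; field_simp; ring
  rw [e, div_le_iff₀ hd]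
  -- The squared estimate is `S(1 - y) ≤ (‖R‖d)²`. For `y ≤ 1` the square root is removed by `(1 -
  -- y)² ≤ 1 - y`; for `y > 1` the claimed bound is negative.
  set y := 2 * d ^ 2 / S ^ 2 with hy
  have hy0 : 0 ≤ y := by positivity
  rcases le_or_gt y 1 with hy1 | hy1
  · refine le_of_sq_le_sq ?_ (by positivity)
    have e2 : S - 2 * d ^ 2 / S = S * (1 - y) := by rw [hy]; field_simp
    rw [e2] at key
    rw [mul_pow, mul_pow, ← hss]
    refine le_trans ?_ key
    gcongr
    nlinarith
  · exact le_trans (by nlinarith) (by positivity : 0 ≤ ‖resolvent T z‖ * d)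

omit happ in
lemma rotated_isUnit {r t : ℝ} (hrt : t ≠ 0 ∨ 1 / 2 < r ^ 2) :
    IsUnit (algebraMap ℂ (H →L[ℂ] H) (rotated r t) - T) := by
  obtain ⟨c, hc, hcl⟩ : ∃ c : ℝ, 0 < c ∧
      ∀ l : ℝ, 0 ≤ l → l ≤ 1 / 2 → c ^ 2 ≤ 4 * r ^ 2 * t ^ 2 + (r ^ 2 - t ^ 2 - l) ^ 2 := by
    by_cases ht : t = 0
    · have hr := hrt.resolve_left (not_not.2 ht)
      exact ⟨r ^ 2 - 1 / 2, by linarith, fun l h0 h1 => by rw [ht]; nlinarith⟩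
    by_cases hr : r = 0
    · exact ⟨t ^ 2, by positivity, fun l h0 h1 => by
        rw [hr]; nlinarith [mul_nonneg h0 (sq_nonneg t), sq_nonneg l]⟩
    · refine ⟨|2 * r * t|, by positivity, fun l h0 h1 => ?_⟩
      rw [sq_abs]; nlinarith [sq_nonneg (r ^ 2 - t ^ 2 - l)]
  refine (h.isUnit_sub hc fun l h0 h1 => ?_).1
  exact le_of_sq_le_sq ((hcl l h0 h1).trans_eq (norm_rotated_sq_sub r t l).symm) (norm_nonneg _)

lemma spectrum_eq : spectrum ℂ T = segment ℝ (-endpoint) endpoint := by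
  ext z
  constructor
  · intro hz
    obtain ⟨r, t, rfl⟩ := exists_eq_rotated z
    by_cases hrt : t ≠ 0 ∨ 1 / 2 < r ^ 2
    · exact absurd (h.rotated_isUnit hrt) hz
    · push Not at hrt
      rw [hrt.1]
      exact rotated_mem_segment hrt.2
  · intro hz hu
    obtain ⟨r, hr, rfl⟩ := exists_of_mem_segment hz
    -- At `l = r²` the distance vanishes, and the lower bound would read `2|z|² + 1 ≤ 0`.
    have := h.le_norm_resolvent_sq happ (sq_nonneg r) hr hu
    rw [norm_rotated_sq_sub] at this
    have h0 : 4 * r ^ 2 * (0 : ℝ) ^ 2 + (r ^ 2 - 0 ^ 2 - r ^ 2) ^ 2 = 0 := by ring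
    rw [h0] at this
    simp only [mul_zero, zero_div, sub_zero] at this
    nlinarith [sq_nonneg ‖rotated r 0‖]

omit happ in
lemma norm_resolvent_rotated_le {r t : ℝ} (hr : r ≠ 0) (ht : t ≠ 0) :
    ‖resolvent T (rotated r t)‖ ≤ A (rotated r t) * (1 / |r|) * (1 / |t|) := by
  have hr' := abs_pos.2 hr
  have ht' := abs_pos.2 ht
  refine (h.norm_resolvent_le (c := 2 * |r| * |t|) (by positivity) fun l _ _ => ?_).trans_eq
    (by field_simp)
  refine le_of_sq_le_sq ?_ (norm_nonneg _)
  rw [norm_rotated_sq_sub, mul_pow, mul_pow, sq_abs, sq_abs]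
  nlinarith [sq_nonneg (r ^ 2 - t ^ 2 - l)]

/-- The choice `l = r² - t²` is the point of the segment closest to `z²/i`, at distance `2|r||t|`.
The condition `|t| ≤ |r|` is what makes it nonnegative. -/
lemma le_norm_resolvent_rotated {r t : ℝ} (hr : r ^ 2 ≤ 1 / 2) (ht : t ≠ 0) (htr : |t| ≤ |r|) :
    A (rotated r t) * (1 / |r|) * (1 / |t|) - B (rotated r t) * |r| * |t|
      ≤ ‖resolvent T (rotated r t)‖ := by
  have ht' := abs_pos.2 ht
  have hr' := ht'.trans_le htr
  have hsq := sq_le_sq.2 htr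
  refine le_trans (le_of_eq ?_) (h.le_norm_resolvent happ (l := r ^ 2 - t ^ 2)
    (d := 2 * |r| * |t|) (by linarith) (by nlinarith [sq_nonneg t])
    (h.rotated_isUnit (Or.inl ht)) (by positivity) ?_)
  · field_simp
  · rw [norm_rotated_sq_sub, mul_pow, mul_pow, sq_abs, sq_abs]; ring

omit happ in
lemma norm_resolvent_rotated_zero_le {t : ℝ} (ht : t ≠ 0) :
    ‖resolvent T (rotated 0 t)‖ ≤ 2 * A (rotated 0 t) * (1 / ‖rotated 0 t‖ ^ 2) := by
  rw [norm_rotated_sq, mul_one_div]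
  refine h.norm_resolvent_le (by positivity) fun l h0 _ => ?_
  refine le_of_sq_le_sq ?_ (norm_nonneg _)
  rw [norm_rotated_sq_sub]
  nlinarith [mul_nonneg h0 (sq_nonneg t), sq_nonneg l]

lemma le_norm_resolvent_rotated_zero {t : ℝ} (ht : t ≠ 0) :
    2 * A (rotated 0 t) * (1 / ‖rotated 0 t‖ ^ 2) - B (rotated 0 t) * (‖rotated 0 t‖ ^ 2 / 2)
      ≤ ‖resolvent T (rotated 0 t)‖ := by
  rw [mul_one_div, ← mul_div_assoc]
  refine h.le_norm_resolvent happ le_rfl (by norm_num) (h.rotated_isUnit (Or.inl ht))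
    (by rw [norm_rotated_sq]; positivity) ?_
  rw [norm_rotated_sq_sub, norm_rotated_sq]; ring

/-- The resolvent estimates near the spectrum. -/
theorem resolvent_estimates :
    spectrum ℂ T = segment ℝ (-endpoint) endpoint ∧
    ∀ ζ ∈ spectrum ℂ T,
      (∀ z ∈ normalLine ζ, z ≠ ζ →
        z ∈ resolventSet ℂ T ∧
        (ζ ≠ 0 → ‖resolvent T z‖ ≤ A z * (1 / ‖ζ‖) * (1 / ‖z - ζ‖)) ∧
        (‖z - ζ‖ ≤ ‖ζ‖ →
          A z * (1 / ‖ζ‖) * (1 / ‖z - ζ‖) - B z * ‖ζ‖ * ‖z - ζ‖ ≤ ‖resolvent T z‖) ∧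
        (ζ = 0 →
          2 * A z * (1 / ‖z‖ ^ 2) - B z * (‖z‖ ^ 2 / 2) ≤ ‖resolvent T z‖ ∧
          (‖z‖ ^ 2 ≤ 2 → 2 * A z * (1 / ‖z‖ ^ 2) - B z ≤ ‖resolvent T z‖) ∧
          ‖resolvent T z‖ ≤ 2 * A z * (1 / ‖z‖ ^ 2))) ∧
      (ζ ≠ 0 →
        (fun z : ℂ => ‖resolvent T z‖ - A ζ / ‖ζ‖ * (1 / ‖z - ζ‖))
          =O[𝓝[normalLine ζ \ {ζ}] ζ] (fun _ : ℂ => (1 : ℝ))) ∧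
      (ζ = 0 →
        (fun z : ℂ => ‖resolvent T z‖ - (‖z‖ ^ 2)⁻¹)
          =O[𝓝[normalLine ζ \ {ζ}] ζ] (fun _ : ℂ => (1 : ℝ))) := by
  have hspec := h.spectrum_eq happ
  refine ⟨hspec, fun ζ hζ => ?_⟩
  rw [hspec] at hζ
  obtain ⟨r, hr, rfl⟩ := exists_of_mem_segment hζ
  have hr0 : rotated r 0 = 0 ↔ r = 0 := by
    rw [← norm_eq_zero, norm_rotated_zero_right, abs_eq_zero]
  refine ⟨?_, ?_, ?_⟩
  · intro z hz hzζ
    obtain ⟨t, rfl⟩ := mem_normalLine_rotated.1 hz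
    have ht : t ≠ 0 := by rintro rfl; exact hzζ rfl
    rw [norm_rotated_sub, norm_rotated_zero_right]
    refine ⟨h.rotated_isUnit (Or.inl ht), fun hz0 => ?_, fun hle => ?_, fun hz0 => ?_⟩
    · exact h.norm_resolvent_rotated_le (fun h0 => hz0 (hr0.2 h0)) ht
    · exact h.le_norm_resolvent_rotated happ hr ht hle
    · obtain rfl := hr0.1 hz0
      refine ⟨h.le_norm_resolvent_rotated_zero happ ht, fun h2 => ?_,
        h.norm_resolvent_rotated_zero_le ht⟩
      refine le_trans ?_ (h.le_norm_resolvent_rotated_zero happ ht)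
      have := B_nonneg (rotated 0 t)
      nlinarith
  · intro hz0
    have hrne : r ≠ 0 := fun h0 => hz0 (hr0.2 h0)
    have hr' := abs_pos.2 hrne
    have hball : ∀ᶠ z in 𝓝[normalLine (rotated r 0) \ {rotated r 0}] (rotated r 0),
        ‖z - rotated r 0‖ < |r| :=
      mem_nhdsWithin_of_mem_nhds (by
        filter_upwards [Metric.ball_mem_nhds (rotated r 0) hr'] with z hz
        rwa [Metric.mem_ball, dist_eq_norm] at hz)
    refine Asymptotics.IsBigO.of_bound 4 ?_
    filter_upwards [hball, self_mem_nhdsWithin] with z hzb hz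
    obtain ⟨t, rfl⟩ := mem_normalLine_rotated.1 hz.1
    have ht : t ≠ 0 := by rintro rfl; exact hz.2 rfl
    rw [norm_rotated_sub] at hzb ⊢
    rw [norm_rotated_zero_right]
    have ht' := abs_pos.2 ht
    have h1 := h.norm_resolvent_rotated_le hrne ht
    have h2 := h.le_norm_resolvent_rotated happ hr ht hzb.le
    have hA := A_rotated_sub_le r t
    have hB := B_le (rotated r t)
    have hB0 := B_nonneg (rotated r t)
    have e : A (rotated r t) * (1 / |r|) * (1 / |t|) - A (rotated r 0) / |r| * (1 / |t|) =
        (A (rotated r t) - A (rotated r 0)) / (|r| * |t|) := by field_simp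
    -- On the ball `|t| < |r|`, the increment `t²/2` is dominated by `|r||t|`.
    have e1 : (A (rotated r t) - A (rotated r 0)) / (|r| * |t|) ≤ 1 := by
      rw [div_le_one (by positivity)]
      have := sq_abs t
      nlinarith
    have e2 : 0 ≤ (A (rotated r t) - A (rotated r 0)) / (|r| * |t|) :=
      div_nonneg hA.1 (by positivity)
    have e3 : B (rotated r t) * |r| * |t| ≤ 4 := by
      have h5 : |r| * |t| ≤ 1 := by nlinarith [sq_abs r]
      nlinarith [mul_pos hr' ht']
    rw [norm_one, mul_one, Real.norm_eq_abs, abs_le]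
    constructor <;> linarith
  · intro hz0
    obtain rfl := hr0.1 hz0
    have hball : ∀ᶠ z in 𝓝[normalLine (rotated 0 0) \ {rotated 0 0}] (rotated 0 0),
        ‖z - rotated 0 0‖ < 1 :=
      mem_nhdsWithin_of_mem_nhds (by
        filter_upwards [Metric.ball_mem_nhds (rotated 0 0) one_pos] with z hz
        rwa [Metric.mem_ball, dist_eq_norm] at hz)
    refine Asymptotics.IsBigO.of_bound 4 ?_
    filter_upwards [hball, self_mem_nhdsWithin] with z hzb hz
    obtain ⟨t, rfl⟩ := mem_normalLine_rotated.1 hz.1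
    have ht : t ≠ 0 := by rintro rfl; exact hz.2 rfl
    rw [norm_rotated_sub] at hzb
    have h1 := h.norm_resolvent_rotated_zero_le ht
    have h2 := h.le_norm_resolvent_rotated_zero happ ht
    rw [norm_rotated_sq] at h1 h2 ⊢
    have hA := A_rotated_sub_le 0 t
    have hA0 : A (rotated 0 0) = 1 / 2 := by rw [A_rotated]; simp
    rw [hA0] at hA
    have hB := B_le (rotated 0 t)
    have hB0 := B_nonneg (rotated 0 t)
    have ht2 : 0 < t ^ 2 := by positivity
    have ht1 : t ^ 2 ≤ 1 := by rw [← sq_abs]; nlinarith [abs_nonneg t]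
    have e : 2 * A (rotated 0 t) * (1 / (0 ^ 2 + t ^ 2)) - (0 ^ 2 + t ^ 2)⁻¹ =
        (2 * A (rotated 0 t) - 1) / t ^ 2 := by
      rw [zero_pow two_ne_zero, zero_add]; field_simp
    have e1 : (2 * A (rotated 0 t) - 1) / t ^ 2 ≤ 1 := by
      rw [div_le_one ht2]; linarith
    have e2 : 0 ≤ (2 * A (rotated 0 t) - 1) / t ^ 2 := div_nonneg (by linarith) ht2.le
    have e3 : B (rotated 0 t) * ((0 ^ 2 + t ^ 2) / 2) ≤ 4 := by nlinarith
    rw [norm_one, mul_one, Real.norm_eq_abs, abs_le]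
    constructor <;> linarith

end IsHalfUnitary

end Abstract

/-! ### Cutoffs of functions to compact subintervals -/

section Cutoff

/-- Lebesgue measure on `(0, ∞)`. -/
abbrev posMeasure : Measure ℝ := (volume : Measure ℝ).restrict (Ioi 0)

lemma norm_sq_eq_integral {α : Type*} {m : MeasurableSpace α} {μ : Measure α} (f : Lp ℂ 2 μ) :
    ‖f‖ ^ 2 = ∫ a, ‖f a‖ ^ 2 ∂μ := by
  have h1 : ((‖f‖ ^ 2 : ℝ) : ℂ) = ((∫ a, ‖f a‖ ^ 2 ∂μ : ℝ) : ℂ) := by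
    rw [← inner_self_ofReal, L2.inner_def, ← integral_complex_ofReal]
    exact integral_congr_ae (ae_of_all _ fun a => inner_self_ofReal (f a))
  exact_mod_cast h1

/-- Multiplication by the indicator of `[a, b]`. -/
def cutoff (a b : ℝ) (x : L2Pos) : L2Pos :=
  ((Lp.memLp x).indicator (measurableSet_Icc (a := a) (b := b))).toLp _

lemma coeFn_cutoff (a b : ℝ) (x : L2Pos) :
    (cutoff a b x : ℝ → ℂ) =ᵐ[posMeasure] (Icc a b).indicator x :=
  MemLp.coeFn_toLp _

lemma cutoff_ae_ne_zero (a b : ℝ) (x : L2Pos) :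
    ∀ᵐ t ∂posMeasure, cutoff a b x t ≠ 0 → t ∈ Icc a b := by
  filter_upwards [coeFn_cutoff a b x] with t ht h
  by_contra hc
  rw [ht, indicator_of_notMem hc] at h
  exact h rfl

lemma integrable_cutoff (a b : ℝ) (x : L2Pos) : Integrable (cutoff a b x : ℝ → ℂ) posMeasure := by
  refine Integrable.congr ?_ (coeFn_cutoff a b x).symm
  rw [integrable_indicator_iff measurableSet_Icc]
  have : IsFiniteMeasure (posMeasure.restrict (Icc a b)) := by
    refine ⟨?_⟩
    rw [Measure.restrict_apply_univ]
    exact (Measure.restrict_apply_le _ _).trans_lt measure_Icc_lt_top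
  exact ((Lp.memLp x).restrict _).integrable (by norm_num)

lemma inner_cutoff_left (a b : ℝ) (x y : L2Pos) :
    ⟪cutoff a b x, y⟫_ℂ = ∫ t in Ioi 0, (Icc a b).indicator (fun t => ⟪x t, y t⟫_ℂ) t := by
  rw [L2.inner_def]
  refine integral_congr_ae ?_
  filter_upwards [coeFn_cutoff a b x] with t ht
  rw [ht]
  by_cases h : t ∈ Icc a b
  · simp only [indicator_of_mem h]
  · simp only [indicator_of_notMem h, inner_zero_left]

lemma inner_cutoff_cutoff (a b : ℝ) (x : L2Pos) :
    ⟪cutoff a b x, cutoff a b x⟫_ℂ = ⟪cutoff a b x, x⟫_ℂ := by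
  rw [inner_cutoff_left, inner_cutoff_left]
  refine integral_congr_ae ?_
  filter_upwards [coeFn_cutoff a b x] with t ht
  by_cases h : t ∈ Icc a b
  · simp only [indicator_of_mem h, ht]
  · simp only [indicator_of_notMem h]

/-- The cutoff to `[1/(n+1), n+1]`. -/
def cutoffSeq (n : ℕ) (x : L2Pos) : L2Pos := cutoff (1 / ((n : ℝ) + 1)) ((n : ℝ) + 1) x

lemma eventually_mem_Icc {t : ℝ} (ht : 0 < t) :
    ∀ᶠ n : ℕ in atTop, t ∈ Icc (1 / ((n : ℝ) + 1)) ((n : ℝ) + 1) := by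
  have h1 : ∀ᶠ n : ℕ in atTop, 1 / ((n : ℝ) + 1) < t :=
    tendsto_one_div_add_atTop_nhds_zero_nat.eventually_lt_const ht
  have h2 : ∀ᶠ n : ℕ in atTop, t ≤ (n : ℝ) := tendsto_natCast_atTop_atTop.eventually_ge_atTop t
  filter_upwards [h1, h2] with n h3 h4
  exact ⟨h3.le, by linarith⟩

lemma tendsto_inner_cutoffSeq (x y : L2Pos) :
    Tendsto (fun n => ⟪cutoffSeq n x, y⟫_ℂ) atTop (𝓝 ⟪x, y⟫_ℂ) := by
  simp only [cutoffSeq, inner_cutoff_left]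
  rw [L2.inner_def]
  have hint := L2.integrable_inner (𝕜 := ℂ) x y
  refine tendsto_integral_of_dominated_convergence (fun t => ‖⟪x t, y t⟫_ℂ‖)
    (fun n => hint.aestronglyMeasurable.indicator measurableSet_Icc) hint.norm
    (fun n => ae_of_all _ fun t => norm_indicator_le_norm_self _ _) ?_
  filter_upwards [ae_restrict_mem measurableSet_Ioi] with t ht
  refine tendsto_const_nhds.congr' ?_
  filter_upwards [eventually_mem_Icc ht] with n hn
  rw [indicator_of_mem hn]

lemma tendsto_cutoffSeq (x : L2Pos) : Tendsto (fun n => cutoffSeq n x) atTop (𝓝 x) := by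
  -- A cutoff is an orthogonal projection, so norm convergence reduces to convergence of `⟪cutoffSeq
  -- n x, x⟫`.
  have h1 : ∀ n, ‖cutoffSeq n x - x‖ ^ 2 = ‖x‖ ^ 2 - (⟪cutoffSeq n x, x⟫_ℂ).re := by
    intro n
    have h2 : ‖cutoffSeq n x‖ ^ 2 = (⟪cutoffSeq n x, x⟫_ℂ).re := by
      rw [cutoffSeq, ← inner_cutoff_cutoff, inner_self_ofReal, Complex.ofReal_re]
    rw [@norm_sub_sq ℂ, h2, RCLike.re_to_complex]
    ring
  have h3 : Tendsto (fun n => ‖cutoffSeq n x - x‖ ^ 2) atTop (𝓝 0) := by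
    simp_rw [h1]
    have h4 := (Complex.continuous_re.tendsto _).comp (tendsto_inner_cutoffSeq x x)
    rw [inner_self_ofReal, Complex.ofReal_re] at h4
    have h5 := (tendsto_const_nhds (x := ‖x‖ ^ 2)).sub h4
    rwa [show ‖x‖ ^ 2 - ‖x‖ ^ 2 = 0 from sub_self _] at h5
  rw [tendsto_iff_norm_sub_tendsto_zero]
  have h5 := h3.sqrt
  simpa [Real.sqrt_sq] using h5

lemma ext_of_inner_cutoff {u v : L2Pos}
    (huv : ∀ a b : ℝ, 0 < a → ∀ y, ⟪cutoff a b y, u⟫_ℂ = ⟪cutoff a b y, v⟫_ℂ) : u = v := by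
  refine ext_inner_left ℂ fun y => ?_
  refine tendsto_nhds_unique (tendsto_inner_cutoffSeq y u) ?_
  refine (tendsto_inner_cutoffSeq y v).congr fun n => ?_
  exact (huv _ _ (by positivity) y).symm

end Cutoff

/-! ### The adjoint and Plancherel's identity -/

section FourierIntegral

/-- The integral `(2π)^{-1/2} ∫_{ξ > 0} x(ξ) e^{i t ξ} dξ` for all real `t`. -/
def fourierPos (x : ℝ → ℂ) (t : ℝ) : ℂ :=
  ((Real.sqrt (2 * Real.pi))⁻¹ : ℂ) * ∫ ξ in Ioi (0 : ℝ), x ξ * Complex.exp (Complex.I * t * ξ)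

lemma coeFn_fourierPlancherel_extendZero (x : L2Pos) (hx : Integrable (x : ℝ → ℂ) posMeasure) :
    (fourierPlancherel (extendZero x) : ℝ → ℂ) =ᵐ[volume] fourierPos x := by
  have he : (extendZero x : ℝ → ℂ) =ᵐ[volume] (Ioi (0 : ℝ)).indicator (x : ℝ → ℂ) :=
    (memLp_indicator_pos x).coeFn_toLp
  have hint : Integrable (extendZero x : ℝ → ℂ) volume :=
    ((integrable_indicator_iff measurableSet_Ioi).2 hx).congr he.symm
  have hd : (fourierPlancherel (extendZero x) : ℝ → ℂ) =ᵐ[volume]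
      fun t : ℝ => ((Real.sqrt (2 * Real.pi))⁻¹ : ℂ) *
        (𝓕⁻ (extendZero x) : L2Line) ((2 * Real.pi)⁻¹ * t) :=
    (memLp_dilation (Lp.memLp (𝓕⁻ (extendZero x) : L2Line))).coeFn_toLp
  filter_upwards [hd, quasiMeasurePreserving_dilation.ae (coeFn_fourierInv _ hint)] with t h2 h3
  rw [h2, h3, Real.fourierInv_eq', fourierPos, ← integral_indicator measurableSet_Ioi]
  congr 1
  refine integral_congr_ae ?_
  filter_upwards [he] with ξ hξ
  rw [hξ]
  by_cases h : ξ ∈ Ioi (0 : ℝ)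
  · simp only [indicator_of_mem h, smul_eq_mul]
    rw [mul_comm]
    congr 2
    have : (Real.pi : ℂ) ≠ 0 := by exact_mod_cast Real.pi_ne_zero
    simp
    field_simp
  · simp [indicator_of_notMem h]

lemma norm_fourierPlancherel_extendZero (x : L2Pos) :
    ‖fourierPlancherel (extendZero x)‖ = ‖x‖ := by
  have h1 : ∀ f : L2Line, ‖dilation f‖ = ‖f‖ := by
    intro f
    change ‖(memLp_dilation (Lp.memLp f)).toLp _‖ = ‖f‖
    rw [Lp.norm_toLp, eLpNorm_dilation (Lp.aestronglyMeasurable f), Lp.norm_def]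
  have h2 : ∀ f : L2Line, ‖(𝓕⁻ f : L2Line)‖ = ‖f‖ := by
    intro f
    rw [← Lp.norm_fourier_eq, FourierTransform.fourier_fourierInv_eq]
  have h3 : ‖extendZero x‖ = ‖x‖ := by
    change ‖(memLp_indicator_pos x).toLp _‖ = ‖x‖
    rw [Lp.norm_toLp, eLpNorm_indicator_eq_eLpNorm_restrict measurableSet_Ioi, Lp.norm_def]
  change ‖dilation (𝓕⁻ (extendZero x) : L2Line)‖ = ‖x‖
  rw [h1, h2, h3]

lemma memLp_fourierPos (x : L2Pos) (hx : Integrable (x : ℝ → ℂ) posMeasure) :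
    MemLp (fourierPos x) 2 volume :=
  (memLp_congr_ae (coeFn_fourierPlancherel_extendZero x hx)).1 (Lp.memLp _)

lemma memLp_fourierPos_neg (x : L2Pos) (hx : Integrable (x : ℝ → ℂ) posMeasure) :
    MemLp (fun t => fourierPos x (-t)) 2 posMeasure :=
  ((memLp_fourierPos x hx).comp_measurePreserving (Measure.measurePreserving_neg volume)).restrict _

lemma conj_fourierPos (x : ℝ → ℂ) (t : ℝ) :
    conj (fourierPos x t) = ((Real.sqrt (2 * Real.pi))⁻¹ : ℂ) *
      ∫ ξ in Ioi (0 : ℝ), conj (x ξ) * Complex.exp (-(Complex.I * t * ξ)) := by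
  rw [fourierPos, map_mul, ← integral_conj]
  simp [← Complex.exp_conj]

/-- Fubini's theorem against cutoff vectors: both functions are integrable and the exponential is
unimodular, so the double integral converges absolutely. -/
lemma star_truncatedFourier_coeFn (x : L2Pos) (hx : Integrable (x : ℝ → ℂ) posMeasure) :
    (star truncatedFourier x : ℝ → ℂ) =ᵐ[posMeasure] fun t => fourierPos x (-t) := by
  suffices hs : star truncatedFourier x = (memLp_fourierPos_neg x hx).toLp _ by
    rw [hs]; exact MemLp.coeFn_toLp _
  refine ext_of_inner_cutoff fun a b _ y => ?_
  have hy := integrable_cutoff a b y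
  set w := cutoff a b y
  rw [ContinuousLinearMap.star_eq_adjoint, ContinuousLinearMap.adjoint_inner_right, L2.inner_def,
    L2.inner_def]
  have e1 : ∫ t in Ioi 0, ⟪truncatedFourier w t, x t⟫_ℂ =
      ∫ t in Ioi (0 : ℝ), ∫ ξ in Ioi (0 : ℝ), ((Real.sqrt (2 * Real.pi))⁻¹ : ℂ) *
        (Complex.exp (-(Complex.I * t * ξ)) * (x t * conj (w ξ))) := by
    refine integral_congr_ae ?_
    filter_upwards [truncatedFourier_coeFn w hy] with t ht
    rw [ht, RCLike.inner_apply]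
    change x t * conj (fourierPos w t) = _
    rw [conj_fourierPos, integral_const_mul, mul_left_comm, ← integral_const_mul]
    congr 1
    refine integral_congr_ae (ae_of_all _ fun ξ => ?_)
    ring
  have e2 : ∫ ξ in Ioi 0, ⟪w ξ, (memLp_fourierPos_neg x hx).toLp _ ξ⟫_ℂ =
      ∫ ξ in Ioi (0 : ℝ), ∫ t in Ioi (0 : ℝ), ((Real.sqrt (2 * Real.pi))⁻¹ : ℂ) *
        (Complex.exp (-(Complex.I * t * ξ)) * (x t * conj (w ξ))) := by
    refine integral_congr_ae ?_
    filter_upwards [(memLp_fourierPos_neg x hx).coeFn_toLp] with ξ hξ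
    rw [hξ, RCLike.inner_apply, fourierPos, integral_const_mul, mul_assoc, ← integral_mul_const]
    congr 1
    refine integral_congr_ae (ae_of_all _ fun t => ?_)
    have : Complex.I * ((-ξ : ℝ) : ℂ) * t = -(Complex.I * t * ξ) := by push_cast; ring
    simp only [this]
    ring
  rw [e1, e2]
  refine integral_integral_swap ?_
  refine Integrable.const_mul ?_ _
  have hw : Integrable (fun ξ => conj (w ξ)) posMeasure := by
    rw [← integrable_norm_iff (Complex.continuous_conj.comp_aestronglyMeasurable hy.1)]
    simpa using hy.norm
  refine (hx.mul_prod hw).bdd_mul (c := 1) ?_ (ae_of_all _ fun p => ?_)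
  · exact Continuous.aestronglyMeasurable (by fun_prop)
  · rw [Complex.norm_exp]; simp

/-- Plancherel's identity for the two half-lines. -/
lemma norm_truncatedFourier_sq_add (x : L2Pos) :
    ‖truncatedFourier x‖ ^ 2 + ‖star truncatedFourier x‖ ^ 2 = ‖x‖ ^ 2 := by
  have key : ∀ n, ‖truncatedFourier (cutoffSeq n x)‖ ^ 2 +
      ‖star truncatedFourier (cutoffSeq n x)‖ ^ 2 = ‖cutoffSeq n x‖ ^ 2 := by
    intro n
    have hy : Integrable (cutoffSeq n x : ℝ → ℂ) posMeasure := integrable_cutoff _ _ x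
    generalize cutoffSeq n x = y at hy ⊢
    have hint : Integrable (fun t => ‖fourierPos y t‖ ^ 2) volume :=
      (memLp_fourierPos y hy).integrable_norm_pow (by norm_num)
    rw [← norm_fourierPlancherel_extendZero y, norm_sq_eq_integral, norm_sq_eq_integral,
      norm_sq_eq_integral]
    have e1 : ∫ t in Ioi 0, ‖truncatedFourier y t‖ ^ 2 = ∫ t in Ioi 0, ‖fourierPos y t‖ ^ 2 :=
      integral_congr_ae (by
        filter_upwards [truncatedFourier_coeFn y hy] with t ht
        rw [ht]; rfl)
    -- Reflection turns the contribution of the adjoint into the part of the transform on the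
    -- negative half-line.
    have e2 : ∫ t in Ioi 0, ‖star truncatedFourier y t‖ ^ 2 =
        ∫ t in Iic 0, ‖fourierPos y t‖ ^ 2 := by
      have := integral_comp_neg_Ioi 0 (fun t => ‖fourierPos y t‖ ^ 2)
      rw [neg_zero] at this
      rw [← this]
      exact integral_congr_ae (by
        filter_upwards [star_truncatedFourier_coeFn y hy] with t ht
        rw [ht])
    have e3 : ∫ t, ‖fourierPlancherel (extendZero y) t‖ ^ 2 = ∫ t, ‖fourierPos y t‖ ^ 2 :=
      integral_congr_ae (by
        filter_upwards [coeFn_fourierPlancherel_extendZero y hy] with t ht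
        rw [ht])
    rw [e1, e2, e3, ← integral_add_compl measurableSet_Ioi hint, compl_Ioi]
  have hT : Tendsto (fun n => truncatedFourier (cutoffSeq n x)) atTop (𝓝 (truncatedFourier x)) :=
    (truncatedFourier.continuous.tendsto x).comp (tendsto_cutoffSeq x)
  have hS : Tendsto (fun n => star truncatedFourier (cutoffSeq n x)) atTop
      (𝓝 (star truncatedFourier x)) :=
    ((star truncatedFourier).continuous.tendsto x).comp (tendsto_cutoffSeq x)
  refine tendsto_nhds_unique ((hT.norm.pow 2).add (hS.norm.pow 2)) ?_
  simp_rw [key]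
  exact (tendsto_cutoffSeq x).norm.pow 2

lemma star_mul_add_mul_star :
    star truncatedFourier * truncatedFourier + truncatedFourier * star truncatedFourier = 1 := by
  have h0 := (inner_map_self_eq_zero ((star truncatedFourier * truncatedFourier +
    truncatedFourier * star truncatedFourier - 1 : L2Pos →L[ℂ] L2Pos) : L2Pos →ₗ[ℂ] L2Pos)).1 ?_
  · rw [← sub_eq_zero]
    ext1 x
    exact congrArg (fun L : L2Pos →ₗ[ℂ] L2Pos => L x) h0
  · intro x
    rw [← inner_conj_symm, ContinuousLinearMap.coe_coe, sub_apply, add_apply, inner_sub_right,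
      inner_add_right, inner_star_mul_self, inner_mul_star_self, one_apply_eq_self,
      inner_self_ofReal, ← norm_truncatedFourier_sq_add x]
    simp

end FourierIntegral

/-! ### The square as a Carleman operator, and its positivity -/

section Kernel

/-- Serves two purposes: with an oscillating exponent damped by `δ` it computes the square of the
operator, and with a real negative exponent it gives positivity. Decay is required only where `w` is
nonzero. -/
lemma integral_integral_mul_exp {α : Type*} [MeasurableSpace α] {ν : Measure α} [SFinite ν]
    {w κ : α → ℂ} (hw : Integrable w ν) (hκ : Measurable κ) {δ : ℝ} (hδ : 0 < δ)
    (hre : ∀ᵐ p ∂ν, w p ≠ 0 → (κ p).re ≤ -δ) :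
    ∫ ξ in Ioi (0 : ℝ), ∫ p, w p * Complex.exp (κ p * ξ) ∂ν = ∫ p, w p * -(κ p)⁻¹ ∂ν := by
  rw [integral_integral_swap]
  · refine integral_congr_ae ?_
    filter_upwards [hre] with p hp
    by_cases h0 : w p = 0
    · simp [h0]
    · rw [integral_const_mul, integral_exp_mul_complex_Ioi (by linarith [hp h0])]
      simp [div_eq_mul_inv]
  · have hexp : Integrable (fun ξ : ℝ => Real.exp (-δ * ξ)) posMeasure :=
      integrableOn_exp_mul_Ioi (neg_lt_zero.2 hδ) 0
    refine (hexp.mul_prod hw.norm).mono' ?_ ?_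
    · have h1 : AEStronglyMeasurable (fun p : ℝ × α => w p.2) (posMeasure.prod ν) := hw.1.comp_snd
      have h2 : Measurable fun p : ℝ × α => Complex.exp (κ p.2 * p.1) := by fun_prop
      exact h1.mul h2.aestronglyMeasurable
    · filter_upwards [Measure.quasiMeasurePreserving_snd.ae hre,
        Measure.quasiMeasurePreserving_fst.ae (ae_restrict_mem (μ := volume) measurableSet_Ioi)]
        with p hp hp1
      have hp1 : 0 < p.1 := hp1
      simp only [Function.uncurry]
      by_cases h0 : w p.2 = 0
      · simp [h0]
      · rw [norm_mul, mul_comm, Complex.norm_exp]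
        gcongr
        rw [Complex.re_mul_ofReal]
        exact mul_le_mul_of_nonneg_right (hp h0) hp1.le

lemma integrable_conj_mul {x y : ℝ → ℂ} (hy : Integrable y posMeasure)
    (hx : Integrable x posMeasure) :
    Integrable (fun p : ℝ × ℝ => conj (y p.1) * x p.2) (posMeasure.prod posMeasure) := by
  refine Integrable.mul_prod (f := fun t => conj (y t)) ?_ hx
  rw [← integrable_norm_iff (Complex.continuous_conj.comp_aestronglyMeasurable hy.1)]
  simpa using hy.norm

lemma ae_prod_cutoff_ne_zero (a b c d : ℝ) (y x : L2Pos) :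
    ∀ᵐ p ∂(posMeasure.prod posMeasure),
      conj (cutoff a b y p.1) * cutoff c d x p.2 ≠ 0 → a ≤ p.1 ∧ c ≤ p.2 := by
  filter_upwards [Measure.quasiMeasurePreserving_fst.ae (cutoff_ae_ne_zero a b y),
    Measure.quasiMeasurePreserving_snd.ae (cutoff_ae_ne_zero c d x)] with p h1 h2 h
  have h3 := mul_ne_zero_iff.1 h
  exact ⟨(h1 (by simpa using h3.1)).1, (h2 h3.2).1⟩

/-- On functions supported away from `0` and `∞` the square of the truncated Fourier operator is
`i / 2π` times the Carleman operator with kernel `1 / (t + s)`. -/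
lemma inner_truncatedFourier_sq {a b c d : ℝ} (ha : 0 < a) (hc : 0 < c) (y x : L2Pos) :
    ⟪cutoff a b y, truncatedFourier (truncatedFourier (cutoff c d x))⟫_ℂ =
      Complex.I / (2 * Real.pi) * ∫ p, conj (cutoff a b y p.1) * cutoff c d x p.2 *
        ((p.1 + p.2 : ℝ) : ℂ)⁻¹ ∂(posMeasure.prod posMeasure) := by
  have hy := integrable_cutoff a b y
  have hx := integrable_cutoff c d x
  have hsupp := ae_prod_cutoff_ne_zero a b c d y x
  have hw := integrable_conj_mul hy hx
  generalize cutoff a b y = u at *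
  generalize cutoff c d x = v at *
  set w : ℝ × ℝ → ℂ := fun p => conj (u p.1) * v p.2 with hwdef
  set ν := posMeasure.prod posMeasure with hν
  set k : ℂ := ((Real.sqrt (2 * Real.pi))⁻¹ : ℂ) with hk
  have hkk : k * k = (2 * Real.pi : ℂ)⁻¹ := by
    rw [hk, ← mul_inv, ← Complex.ofReal_mul, Real.mul_self_sqrt Real.two_pi_pos.le]; push_cast; rfl
  set Q : ℝ → ℂ := fun ξ => ∫ p, w p * Complex.exp (Complex.I * (p.1 + p.2) * ξ) ∂ν with hQ
  have hQprod : ∀ ξ : ℝ, fourierPos v ξ * conj (fourierPos u (-ξ)) = k * k * Q ξ := by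
    intro ξ
    have h1 : Q ξ = (∫ t in Ioi (0 : ℝ), conj (u t) * Complex.exp (Complex.I * t * ξ)) *
        ∫ s in Ioi (0 : ℝ), v s * Complex.exp (Complex.I * s * ξ) := by
      rw [← integral_prod_mul]
      refine integral_congr_ae (ae_of_all _ fun p => ?_)
      simp only [hwdef]
      rw [mul_add, add_mul, Complex.exp_add]
      ring
    rw [conj_fourierPos, fourierPos, h1]
    have h2 : ∀ t : ℝ, -(Complex.I * ((-ξ : ℝ) : ℂ) * t) = Complex.I * t * ξ := by
      intro t; push_cast; ring
    have h3 : ∀ s : ℝ, Complex.I * ξ * s = Complex.I * s * ξ := by intro s; ring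
    simp only [h2, h3, ← hk]
    ring
  have hcongr : (fun ξ => ⟪star truncatedFourier u ξ, truncatedFourier v ξ⟫_ℂ) =ᵐ[posMeasure]
      fun ξ => k * k * Q ξ := by
    filter_upwards [truncatedFourier_coeFn v hx, star_truncatedFourier_coeFn u hy] with ξ h1 h2
    rw [h1, h2, RCLike.inner_apply]
    exact hQprod ξ
  have hk0 : k * k ≠ 0 := by
    rw [hkk]; exact inv_ne_zero (by exact_mod_cast Real.two_pi_pos.ne')
  -- Integrability is inherited from the inner product of two `L²` functions; absolute convergence
  -- of the triple integral is not available.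
  have hQint : Integrable Q posMeasure := by
    have h1 := (L2.integrable_inner (𝕜 := ℂ) (star truncatedFourier u)
      (truncatedFourier v)).congr hcongr
    exact (integrable_const_mul_iff (IsUnit.mk0 _ hk0) _).1 h1
  have hinner : ⟪u, truncatedFourier (truncatedFourier v)⟫_ℂ = k * k * ∫ ξ in Ioi (0 : ℝ), Q ξ := by
    rw [← ContinuousLinearMap.adjoint_inner_left, ← ContinuousLinearMap.star_eq_adjoint,
      L2.inner_def, integral_congr_ae hcongr, integral_const_mul]
  -- Abel summation: `∫ e^{i(t+s)ξ} dξ` diverges, so a factor `e^{-ξ/(n+1)}` is inserted and removed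
  -- in the limit.
  have hlim1 : Tendsto (fun n : ℕ => ∫ ξ in Ioi (0 : ℝ),
      Complex.exp (-((1 / ((n : ℝ) + 1) : ℝ) : ℂ) * ξ) * Q ξ) atTop
      (𝓝 (∫ ξ in Ioi (0 : ℝ), Q ξ)) := by
    refine tendsto_integral_of_dominated_convergence (fun ξ => ‖Q ξ‖) (fun n => ?_) hQint.norm
      (fun n => ?_) (ae_of_all _ fun ξ => ?_)
    · exact (Continuous.aestronglyMeasurable (by fun_prop)).mul hQint.1
    · filter_upwards [ae_restrict_mem measurableSet_Ioi] with ξ hξ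
      have hξ : 0 < ξ := hξ
      rw [norm_mul, Complex.norm_exp]
      refine mul_le_of_le_one_left (norm_nonneg _) (Real.exp_le_one_iff.2 ?_)
      rw [Complex.re_mul_ofReal, Complex.neg_re, Complex.ofReal_re]
      have : 0 ≤ 1 / ((n : ℝ) + 1) * ξ := by positivity
      linarith
    · have h1 : Tendsto (fun n : ℕ => -((1 / ((n : ℝ) + 1) : ℝ) : ℂ) * ξ) atTop (𝓝 0) := by
        have h2 := (Complex.continuous_ofReal.tendsto _).comp
          (tendsto_one_div_add_atTop_nhds_zero_nat (𝕜 := ℝ))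
        simpa using (h2.neg.mul_const (ξ : ℂ))
      simpa using ((Complex.continuous_exp.tendsto _).comp h1).mul_const (Q ξ)
  have hreg : ∀ n : ℕ, ∫ ξ in Ioi (0 : ℝ),
      Complex.exp (-((1 / ((n : ℝ) + 1) : ℝ) : ℂ) * ξ) * Q ξ =
      ∫ p, w p * -(-((1 / ((n : ℝ) + 1) : ℝ) : ℂ) + Complex.I * (p.1 + p.2))⁻¹ ∂ν := by
    intro n
    rw [← integral_integral_mul_exp hw (δ := 1 / ((n : ℝ) + 1)) (by fun_prop) (by positivity)
      (ae_of_all _ fun p _ => by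
        rw [Complex.add_re, Complex.neg_re, Complex.ofReal_re]; simp)]
    refine integral_congr_ae (ae_of_all _ fun ξ => ?_)
    simp only [hQ]
    rw [← integral_const_mul]
    refine integral_congr_ae (ae_of_all _ fun p => ?_)
    simp only
    rw [add_mul, Complex.exp_add]
    ring
  -- The denominator has imaginary part `t + s ≥ a` on the support of `w`, whence the dominating
  -- function.
  have hlim2 : Tendsto (fun n : ℕ => ∫ p, w p *
      -(-((1 / ((n : ℝ) + 1) : ℝ) : ℂ) + Complex.I * (p.1 + p.2))⁻¹ ∂ν) atTop
      (𝓝 (∫ p, w p * -(Complex.I * (p.1 + p.2))⁻¹ ∂ν)) := by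
    refine tendsto_integral_of_dominated_convergence (fun p => ‖w p‖ * a⁻¹) (fun n => ?_)
      (hw.norm.mul_const _) (fun n => ?_) ?_
    · exact hw.1.mul (Measurable.aestronglyMeasurable (by fun_prop))
    · filter_upwards [hsupp] with p hp
      rw [norm_mul]
      by_cases h0 : w p = 0
      · simp [h0]
      have hp' := hp h0
      rw [norm_neg, norm_inv]
      gcongr
      refine le_trans ?_ (Complex.abs_im_le_norm _)
      refine le_trans ?_ (le_abs_self _)
      simp only [Complex.add_im, Complex.neg_im, Complex.ofReal_im, Complex.I_mul_im,
        Complex.add_re, Complex.ofReal_re]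
      linarith
    · filter_upwards [hsupp] with p hp
      by_cases h0 : w p = 0
      · simp [h0]
      have hp' := hp h0
      have hne : Complex.I * ((p.1 : ℂ) + p.2) ≠ 0 := by
        refine mul_ne_zero Complex.I_ne_zero ?_
        rw [← Complex.ofReal_add, Complex.ofReal_ne_zero]
        linarith
      have h2 := (Complex.continuous_ofReal.tendsto _).comp
        (tendsto_one_div_add_atTop_nhds_zero_nat (𝕜 := ℝ))
      have h3 := h2.neg.add_const (Complex.I * ((p.1 : ℂ) + p.2))
      rw [Complex.ofReal_zero, neg_zero, zero_add] at h3
      exact ((h3.inv₀ hne).neg).const_mul (w p)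
  simp_rw [hreg] at hlim1
  rw [hinner, tendsto_nhds_unique hlim1 hlim2, hkk, div_eq_mul_inv, mul_comm Complex.I, mul_assoc]
  congr 1
  rw [← integral_const_mul]
  refine integral_congr_ae (ae_of_all _ fun p => ?_)
  simp only [hwdef]
  rw [mul_inv, Complex.inv_I]
  push_cast
  ring

/-- The operator `-i ℱ₊²`. -/
def carleman : L2Pos →L[ℂ] L2Pos := (-Complex.I) • (truncatedFourier * truncatedFourier)

lemma inner_carleman {a b c d : ℝ} (ha : 0 < a) (hc : 0 < c) (y x : L2Pos) :
    ⟪cutoff a b y, carleman (cutoff c d x)⟫_ℂ =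
      (2 * Real.pi : ℂ)⁻¹ * ∫ p, conj (cutoff a b y p.1) * cutoff c d x p.2 *
        ((p.1 + p.2 : ℝ) : ℂ)⁻¹ ∂(posMeasure.prod posMeasure) := by
  rw [carleman, smul_apply, mul_apply_eq_comp, inner_smul_right, inner_truncatedFourier_sq ha hc,
    ← mul_assoc]
  congr 1
  rw [div_eq_mul_inv, ← mul_assoc]
  simp

/-- Writing `1/(t + s)` as `∫ e^{-(t+s)ξ} dξ` turns the form into `(2π)⁻¹` times the squared `L²`
norm of the Laplace transform. -/
lemma inner_carleman_cutoff_nonneg {a b : ℝ} (ha : 0 < a) (x : L2Pos) :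
    ∃ c : ℝ, 0 ≤ c ∧ ⟪cutoff a b x, carleman (cutoff a b x)⟫_ℂ = c := by
  have hx := integrable_cutoff a b x
  have hw := integrable_conj_mul hx hx
  have hsupp := ae_prod_cutoff_ne_zero a b a b x x
  have hinner := inner_carleman (b := b) (d := b) ha ha x x
  generalize cutoff a b x = v at *
  have key := integral_integral_mul_exp hw
    (κ := fun p : ℝ × ℝ => -((p.1 + p.2 : ℝ) : ℂ)) (by fun_prop) ha (by
      filter_upwards [hsupp] with p hp h0
      have := hp h0
      simp only [Complex.neg_re, Complex.ofReal_re]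
      linarith)
  set L : ℝ → ℂ := fun ξ => ∫ s in Ioi (0 : ℝ), v s * Complex.exp (-(s * ξ)) with hL
  have hsq : ∀ ξ : ℝ, ∫ p, conj (v p.1) * v p.2 * Complex.exp (-((p.1 + p.2 : ℝ) : ℂ) * ξ)
      ∂(posMeasure.prod posMeasure) = ((‖L ξ‖ ^ 2 : ℝ) : ℂ) := by
    intro ξ
    rw [Complex.ofReal_pow, ← Complex.conj_mul', hL, ← integral_conj, ← integral_prod_mul]
    refine integral_congr_ae (ae_of_all _ fun p => ?_)
    simp only [map_mul, ← Complex.exp_conj, map_neg, Complex.conj_ofReal]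
    rw [show -((p.1 + p.2 : ℝ) : ℂ) * ξ = -(p.1 * ξ) + -(p.2 * ξ) by push_cast; ring,
      Complex.exp_add]
    ring
  simp_rw [hsq, neg_inv, neg_neg] at key
  rw [integral_complex_ofReal] at key
  refine ⟨(2 * Real.pi)⁻¹ * ∫ ξ in Ioi (0 : ℝ), ‖L ξ‖ ^ 2, ?_, ?_⟩
  · have := integral_nonneg (μ := posMeasure) (f := fun ξ => ‖L ξ‖ ^ 2) (fun ξ => by positivity)
    positivity
  · rw [hinner, ← key]; push_cast; rfl

lemma carleman_isPositive : carleman.IsPositive := by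
  rw [ContinuousLinearMap.isPositive_iff_complex]
  intro x
  have hcl : IsClosed {w : ℂ | 0 ≤ w.re ∧ w.im = 0} :=
    (isClosed_le continuous_const Complex.continuous_re).inter
      (isClosed_eq Complex.continuous_im continuous_const)
  have hlim : Tendsto (fun n => ⟪carleman (cutoffSeq n x), cutoffSeq n x⟫_ℂ) atTop
      (𝓝 ⟪carleman x, x⟫_ℂ) :=
    ((carleman.continuous.tendsto x).comp (tendsto_cutoffSeq x)).inner (tendsto_cutoffSeq x)
  have hmem := hcl.mem_of_tendsto hlim (Eventually.of_forall fun n => by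
    obtain ⟨c, hc, hc'⟩ := inner_carleman_cutoff_nonneg
      (a := 1 / ((n : ℝ) + 1)) (b := (n : ℝ) + 1) (by positivity) x
    rw [← inner_conj_symm, cutoffSeq, hc', Complex.conj_ofReal]
    exact ⟨by simpa using hc, by simp⟩)
  exact ⟨Complex.ext (by simp) (by simpa using hmem.2.symm), hmem.1⟩

lemma isHalfUnitary_truncatedFourier : IsHalfUnitary truncatedFourier carleman where
  add_eq_one := star_mul_add_mul_star
  sq_eq := by rw [carleman, smul_smul]; simp
  pos := carleman_isPositive

end Kernel

/-! ### The Mellin symbol of the Carleman operator -/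

section Symbol

/-- The Mellin multiplier `(2π)⁻¹ ∫ r^{-1/2 + iμ} / (1 + r) dr` of the Carleman operator. -/
def carlemanSymbol (μ : ℝ) : ℂ :=
  (2 * Real.pi : ℂ)⁻¹ * mellin (fun r : ℝ => ((1 + r : ℝ) : ℂ)⁻¹) (1 / 2 + Complex.I * μ)

lemma carlemanSymbol_eq (μ : ℝ) : carlemanSymbol μ = (2 * Real.pi : ℂ)⁻¹ *
    ∫ r in Ioi (0 : ℝ), (r : ℂ) ^ (-1 / 2 + Complex.I * μ) * ((1 + r : ℝ) : ℂ)⁻¹ := by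
  rw [carlemanSymbol, mellin]
  congr 3
  ext r
  rw [smul_eq_mul]
  congr 2
  ring

lemma continuous_carlemanSymbol : Continuous carlemanSymbol := by
  refine continuous_const.mul (continuous_iff_continuousAt.2 fun μ => ?_)
  have hd : DifferentiableAt ℂ (mellin (fun r : ℝ => ((1 + r : ℝ) : ℂ)⁻¹))
      (1 / 2 + Complex.I * μ) := by
    -- The line `Re s = 1/2` lies inside the strip `0 < Re s < 1` of holomorphy, by the bounds
    -- `O(1/r)` at infinity and `O(1)` at zero.
    refine mellin_differentiableAt_of_isBigO_rpow (a := 1) (b := 0) ?_ ?_ ?_ ?_ ?_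
    · refine ContinuousOn.locallyIntegrableOn ?_ measurableSet_Ioi
      refine ContinuousOn.inv₀ (by fun_prop) fun r hr => ?_
      have hr : 0 < r := hr
      exact_mod_cast (by positivity : (1 + r) ≠ 0)
    · refine Asymptotics.IsBigO.of_bound 1 ?_
      filter_upwards [eventually_gt_atTop (0 : ℝ)] with r hr
      rw [norm_inv, Complex.norm_real, Real.rpow_neg_one, norm_inv, one_mul,
        Real.norm_of_nonneg hr.le, Real.norm_of_nonneg (by positivity)]
      gcongr
      linarith
    · simp; norm_num
    · refine Asymptotics.IsBigO.of_bound 1 ?_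
      filter_upwards [self_mem_nhdsWithin] with r hr
      have hr : 0 < r := hr
      rw [norm_inv, Complex.norm_real, neg_zero, Real.rpow_zero, norm_one, one_mul,
        Real.norm_of_nonneg (by positivity)]
      exact inv_le_one_of_one_le₀ (by linarith)
    · simp
  exact ContinuousAt.comp (f := fun μ : ℝ => (1 / 2 + Complex.I * μ : ℂ)) hd.continuousAt
    (by fun_prop)

/-- The substitution `r = e^{-u}` makes the symbol a Fourier transform, and the Riemann–Lebesgue
lemma applies. -/
lemma tendsto_carlemanSymbol : Tendsto carlemanSymbol atTop (𝓝 0) := by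
  set G : ℝ → ℂ := fun u => Real.exp (-(1 / 2) * u) • ((1 + Real.exp (-u) : ℝ) : ℂ)⁻¹ with hG
  have h1 : ∀ μ, carlemanSymbol μ = (2 * Real.pi : ℂ)⁻¹ * 𝓕 G (μ / (2 * Real.pi)) := by
    intro μ
    rw [carlemanSymbol, mellin_eq_fourier]
    have h2 : (1 / 2 + Complex.I * μ : ℂ).re = 1 / 2 := by simp
    have h3 : (1 / 2 + Complex.I * μ : ℂ).im = μ := by simp
    rw [h2, h3]
  have h4 : Tendsto (fun μ : ℝ => μ / (2 * Real.pi)) atTop (cocompact ℝ) :=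
    (tendsto_id.atTop_div_const Real.two_pi_pos).mono_right atTop_le_cocompact
  have h5 := ((Real.zero_at_infty_fourier G).comp h4).const_mul (2 * Real.pi : ℂ)⁻¹
  rw [mul_zero] at h5
  exact h5.congr fun μ => (h1 μ).symm

lemma carlemanSymbol_zero : carlemanSymbol 0 = 1 / 2 := by
  have h1 : ∫ r in Ioi (0 : ℝ), (r : ℂ) ^ (-1 / 2 + Complex.I * (0 : ℝ)) * ((1 + r : ℝ) : ℂ)⁻¹ =
      ((∫ r in Ioi (0 : ℝ), r ^ (-1 / 2 : ℝ) * (1 + r)⁻¹ : ℝ) : ℂ) := by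
    rw [← integral_complex_ofReal]
    refine setIntegral_congr_fun measurableSet_Ioi fun r hr => ?_
    have hr : 0 < r := hr
    rw [Complex.ofReal_mul, Complex.ofReal_cpow hr.le]
    simp
  have h2 : ∫ r in Ioi (0 : ℝ), r ^ (-1 / 2 : ℝ) * (1 + r)⁻¹ = Real.pi := by
    -- The substitution `r = v²` leads to the arctangent integral.
    rw [← integral_comp_rpow_Ioi _ (two_ne_zero : (2 : ℝ) ≠ 0)]
    have h3 : ∫ v in Ioi (0 : ℝ), 2 * (1 + v ^ 2)⁻¹ = Real.pi := by
      rw [integral_const_mul, integral_Ioi_inv_one_add_sq, Real.arctan_zero]; ring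
    rw [← h3]
    refine setIntegral_congr_fun measurableSet_Ioi fun v hv => ?_
    have hv : 0 < v := hv
    simp only [smul_eq_mul]
    rw [← Real.rpow_mul hv.le, show (2 : ℝ) * (-1 / 2) = -1 by norm_num, Real.rpow_neg_one,
      show (2 : ℝ) - 1 = 1 by norm_num, Real.rpow_one, Real.rpow_two, abs_two]
    field_simp
  rw [carlemanSymbol_eq, h1, h2]
  have : (Real.pi : ℂ) ≠ 0 := by exact_mod_cast Real.pi_ne_zero
  field_simp

lemma exists_carlemanSymbol_re_eq {l : ℝ} (hl : 0 < l) (hl2 : l < 1 / 2) :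
    ∃ μ : ℝ, (carlemanSymbol μ).re = l := by
  have hc : Continuous fun μ => (carlemanSymbol μ).re :=
    Complex.continuous_re.comp continuous_carlemanSymbol
  have ht : Tendsto (fun μ => (carlemanSymbol μ).re) atTop (𝓝 0) := by
    have := (Complex.continuous_re.tendsto 0).comp tendsto_carlemanSymbol
    simpa [Function.comp_def] using this
  obtain ⟨M, hM0, hM⟩ := ((eventually_ge_atTop (0 : ℝ)).and (ht.eventually_lt_const hl)).exists
  have h0 : (carlemanSymbol 0).re = 1 / 2 := by rw [carlemanSymbol_zero]; simp
  obtain ⟨μ, _, hμ⟩ := intermediate_value_Icc' hM0 hc.continuousOn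
    (show l ∈ Icc (carlemanSymbol M).re (carlemanSymbol 0).re from ⟨hM.le, by rw [h0]; exact hl2.le⟩)
  exact ⟨μ, hμ⟩

end Symbol

/-! ### Truncated generalized eigenfunctions -/

section TestFunctions

lemma integrable_of_rpow_bounds {g : ℝ → ℝ} (hg : AEStronglyMeasurable g posMeasure)
    {C α β : ℝ} (hα : -1 < α) (hβ : β < -1)
    (h0 : ∀ t, 0 < t → t ≤ 1 → |g t| ≤ C * t ^ α) (h1 : ∀ t, 1 < t → |g t| ≤ C * t ^ β) :
    Integrable g posMeasure := by
  have hsplit : Ioi (0 : ℝ) = Ioc 0 1 ∪ Ioi 1 := (Ioc_union_Ioi_eq_Ioi zero_le_one).symm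
  change IntegrableOn g (Ioi 0) volume
  rw [hsplit, integrableOn_union]
  constructor
  · have hi : IntegrableOn (fun t : ℝ => C * t ^ α) (Ioc 0 1) volume :=
      ((intervalIntegrable_iff_integrableOn_Ioc_of_le zero_le_one).1
        (intervalIntegral.intervalIntegrable_rpow' hα)).const_mul C
    refine Integrable.mono' hi (hg.mono_measure (Measure.restrict_mono Ioc_subset_Ioi_self le_rfl)) ?_
    filter_upwards [ae_restrict_mem measurableSet_Ioc] with t ht
    exact h0 t ht.1 ht.2
  · have hi : IntegrableOn (fun t : ℝ => C * t ^ β) (Ioi 1) volume :=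
      (integrableOn_Ioi_rpow_of_lt hβ one_pos).const_mul C
    refine Integrable.mono' hi
      (hg.mono_measure (Measure.restrict_mono (Ioi_subset_Ioi zero_le_one) le_rfl)) ?_
    filter_upwards [ae_restrict_mem measurableSet_Ioi] with t ht
    exact h1 t ht

lemma exp_mul_abs_log_of_le_one {t : ℝ} (c : ℝ) (ht : 0 < t) (ht1 : t ≤ 1) :
    Real.exp (c * |Real.log t|) = t ^ (-c) := by
  rw [abs_of_nonpos (Real.log_nonpos ht.le ht1), Real.rpow_def_of_pos ht]
  congr 1; ring

lemma exp_mul_abs_log_of_one_le {t : ℝ} (c : ℝ) (ht : 1 ≤ t) :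
    Real.exp (c * |Real.log t|) = t ^ c := by
  rw [abs_of_nonneg (Real.log_nonneg ht), Real.rpow_def_of_pos (by linarith)]
  congr 1; ring

/-- The weight `r^{-1/2} e^{|log r| / 4} / (1 + r)`. -/
def weight (r : ℝ) : ℝ := r ^ (-1 / 2 : ℝ) * Real.exp (1 / 4 * |Real.log r|) * (1 + r)⁻¹

/-- The spare factor `e^{|log r|/4}` absorbs the truncation error; the exponents become `-3/4` at
zero and `-5/4` at infinity, still on the integrable side. -/
lemma integrable_weight : Integrable weight posMeasure := by
  refine integrable_of_rpow_bounds (C := 1) (α := -3 / 4) (β := -5 / 4)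
    (Measurable.aestronglyMeasurable (by unfold weight; fun_prop)) (by norm_num) (by norm_num) ?_ ?_
  · intro t ht ht1
    rw [weight, exp_mul_abs_log_of_le_one _ ht ht1, ← Real.rpow_add ht, abs_of_nonneg (by positivity),
      one_mul]
    rw [show (-1 / 2 + -(1 / 4) : ℝ) = -3 / 4 by norm_num]
    exact mul_le_of_le_one_right (by positivity) (inv_le_one_of_one_le₀ (by linarith))
  · intro t ht
    have ht0 : 0 < t := by linarith
    rw [weight, exp_mul_abs_log_of_one_le _ ht.le, ← Real.rpow_add ht0,
      abs_of_nonneg (by positivity), one_mul,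
      show (-5 / 4 : ℝ) = (-1 / 2 + 1 / 4) + -1 by norm_num, Real.rpow_add ht0 (-1 / 2 + 1 / 4),
      Real.rpow_neg_one]
    gcongr
    linarith

/-- The truncation `e^{-ε |log t|}` of the generalized eigenfunction `t^{-1/2 + iμ}`. -/
def testFunction (μ ε t : ℝ) : ℂ :=
  (t : ℂ) ^ (-1 / 2 + Complex.I * μ) * (Real.exp (-ε * |Real.log t|) : ℂ)

lemma norm_cpow_symbol (μ : ℝ) {t : ℝ} (ht : 0 < t) :
    ‖(t : ℂ) ^ (-1 / 2 + Complex.I * μ)‖ = t ^ (-1 / 2 : ℝ) := by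
  rw [Complex.norm_cpow_eq_rpow_re_of_pos ht]
  congr 1
  simp

lemma norm_testFunction (μ ε : ℝ) {t : ℝ} (ht : 0 < t) :
    ‖testFunction μ ε t‖ = t ^ (-1 / 2 : ℝ) * Real.exp (-ε * |Real.log t|) := by
  rw [testFunction, norm_mul, norm_cpow_symbol μ ht, Complex.norm_real,
    Real.norm_of_nonneg (Real.exp_pos _).le]

lemma measurable_testFunction (μ ε : ℝ) : Measurable (testFunction μ ε) := by
  unfold testFunction
  fun_prop

lemma memLp_testFunction (μ : ℝ) {ε : ℝ} (hε : 0 < ε) : MemLp (testFunction μ ε) 2 posMeasure := by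
  rw [memLp_two_iff_integrable_sq_norm (measurable_testFunction μ ε).aestronglyMeasurable]
  have hsq : ∀ t : ℝ, 0 < t → |‖testFunction μ ε t‖ ^ 2| =
      t ^ (-1 : ℝ) * Real.exp (-(2 * ε) * |Real.log t|) := by
    intro t ht
    rw [norm_testFunction μ ε ht, abs_of_nonneg (by positivity), mul_pow, ← Real.rpow_natCast,
      ← Real.rpow_mul ht.le, ← Real.exp_nat_mul]
    congr 2
    · norm_num
    · push_cast; ring
  -- Without the truncation the square is `t⁻¹`, which just fails at both ends; `ε > 0` shifts both
  -- exponents to the right side of `-1`.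
  refine integrable_of_rpow_bounds (C := 1) (α := -1 + 2 * ε) (β := -1 - 2 * ε)
    ((measurable_testFunction μ ε).norm.pow_const 2).aestronglyMeasurable (by linarith)
    (by linarith) ?_ ?_
  · intro t ht ht1
    rw [hsq t ht, exp_mul_abs_log_of_le_one _ ht ht1, ← Real.rpow_add ht, neg_neg, one_mul]
  · intro t ht
    have ht0 : 0 < t := by linarith
    rw [hsq t ht0, exp_mul_abs_log_of_one_le _ ht.le, ← Real.rpow_add ht0, one_mul, ← sub_eq_add_neg]

lemma integrable_norm_testFunction_mul (μ : ℝ) {ε a : ℝ} (hε : 0 < ε) (ha : 0 < a) :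
    Integrable (fun s => ‖testFunction μ ε s‖ * (a + s)⁻¹) posMeasure := by
  have hle : ∀ s : ℝ, 0 < s → ‖testFunction μ ε s‖ ≤ s ^ (-1 / 2 : ℝ) := by
    intro s hs
    rw [norm_testFunction μ ε hs]
    refine mul_le_of_le_one_right (by positivity) (Real.exp_le_one_iff.2 ?_)
    have : 0 ≤ ε * |Real.log s| := by positivity
    linarith
  refine integrable_of_rpow_bounds (C := max a⁻¹ 1) (α := -1 / 2) (β := -3 / 2)
    (Measurable.aestronglyMeasurable ((measurable_testFunction μ ε).norm.mul (by fun_prop)))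
    (by norm_num) (by norm_num) ?_ ?_
  · intro s hs _
    rw [abs_of_nonneg (by positivity), mul_comm]
    gcongr
    · refine le_trans ?_ (le_max_left _ _)
      gcongr
      linarith
    · exact hle s hs
  · intro s hs
    have hs0 : 0 < s := by linarith
    have h1 : s ^ (-3 / 2 : ℝ) = s⁻¹ * s ^ (-1 / 2 : ℝ) := by
      rw [show (-3 / 2 : ℝ) = -1 + -1 / 2 by norm_num, Real.rpow_add hs0, Real.rpow_neg_one]
    rw [abs_of_nonneg (by positivity), mul_comm, h1]
    calc (a + s)⁻¹ * ‖testFunction μ ε s‖ ≤ s⁻¹ * s ^ (-1 / 2 : ℝ) := by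
          gcongr
          · linarith
          · exact hle s hs0
      _ ≤ max a⁻¹ 1 * (s⁻¹ * s ^ (-1 / 2 : ℝ)) :=
          le_mul_of_one_le_left (by positivity) (le_max_right _ _)

lemma abs_exp_sub_one_le_exp_abs (y : ℝ) : |Real.exp y - 1| ≤ Real.exp |y| - 1 := by
  rcases le_total 0 y with hy | hy
  · rw [abs_of_nonneg hy, abs_of_nonneg (by linarith [Real.add_one_le_exp y])]
  · rw [abs_of_nonpos hy, abs_of_nonpos (by linarith [Real.exp_le_one_iff.2 hy])]
    have h1 := Real.exp_pos y
    have h2 : Real.exp y * Real.exp (-y) = 1 := by rw [← Real.exp_add]; simp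
    have h3 := Real.exp_pos (-y)
    nlinarith [sq_nonneg (Real.exp y - Real.exp (-y))]

lemma exp_mul_sub_one_le {ε v : ℝ} (hε : 0 ≤ ε) (hε' : ε ≤ 1 / 8) (hv : 0 ≤ v) :
    Real.exp (ε * v) - 1 ≤ 8 * ε * Real.exp (1 / 4 * v) := by
  have h1 : Real.exp (ε * v) - 1 ≤ ε * v * Real.exp (ε * v) := by
    have h2 := Real.add_one_le_exp (-(ε * v))
    have h3 : Real.exp (-(ε * v)) * Real.exp (ε * v) = 1 := by rw [← Real.exp_add]; simp
    nlinarith [Real.exp_pos (ε * v)]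
  have h4 : v ≤ 8 * Real.exp (v / 8) := by linarith [Real.add_one_le_exp (v / 8)]
  have h5 : Real.exp (ε * v) ≤ Real.exp (v / 8) := Real.exp_le_exp.2 (by nlinarith)
  have h6 : Real.exp (1 / 4 * v) = Real.exp (v / 8) * Real.exp (v / 8) := by
    rw [← Real.exp_add]; congr 1; ring
  calc Real.exp (ε * v) - 1 ≤ ε * v * Real.exp (ε * v) := h1
    _ ≤ ε * (8 * Real.exp (v / 8)) * Real.exp (v / 8) := by gcongr
    _ = _ := by rw [h6]; ring

/-- `|log (t r)|` and `|log t|` differ by at most `|log r|`, so the relative error is `O(ε)`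
uniformly in `t`, with growth controlled by the weight. -/
lemma abs_truncation_sub_le {ε t r : ℝ} (hε : 0 ≤ ε) (hε' : ε ≤ 1 / 8) (ht : 0 < t) (hr : 0 < r) :
    |Real.exp (-ε * |Real.log (t * r)|) - Real.exp (-ε * |Real.log t|)| ≤
      Real.exp (-ε * |Real.log t|) * (8 * ε * Real.exp (1 / 4 * |Real.log r|)) := by
  have h1 : Real.exp (-ε * |Real.log (t * r)|) - Real.exp (-ε * |Real.log t|) =
      Real.exp (-ε * |Real.log t|) *
        (Real.exp (ε * (|Real.log t| - |Real.log (t * r)|)) - 1) := by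
    rw [mul_sub, ← Real.exp_add, mul_one]
    congr 2; ring
  rw [h1, abs_mul, abs_of_pos (Real.exp_pos _)]
  gcongr
  refine (abs_exp_sub_one_le_exp_abs _).trans ?_
  refine le_trans ?_ (exp_mul_sub_one_le hε hε' (abs_nonneg _))
  gcongr
  rw [abs_mul, abs_of_nonneg hε]
  refine mul_le_mul_of_nonneg_left ?_ hε
  have h2 := abs_abs_sub_abs_le_abs_sub (Real.log t) (Real.log (t * r))
  rw [Real.log_mul ht.ne' hr.ne'] at h2 ⊢
  simpa using h2

lemma integral_testFunction (μ ε : ℝ) {t : ℝ} (ht : 0 < t) :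
    ∫ s in Ioi (0 : ℝ), testFunction μ ε s * ((t + s : ℝ) : ℂ)⁻¹ =
      (t : ℂ) ^ (-1 / 2 + Complex.I * μ) * ∫ r in Ioi (0 : ℝ),
        (r : ℂ) ^ (-1 / 2 + Complex.I * μ) * ((1 + r : ℝ) : ℂ)⁻¹ *
          (Real.exp (-ε * |Real.log (t * r)|) : ℂ) := by
  have h1 := integral_comp_mul_left_Ioi
    (fun s => testFunction μ ε s * ((t + s : ℝ) : ℂ)⁻¹) 0 ht
  rw [mul_zero, eq_inv_smul_iff₀ ht.ne'] at h1
  rw [← h1, ← integral_smul, ← integral_const_mul]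
  refine setIntegral_congr_fun measurableSet_Ioi fun r hr => ?_
  have hr : 0 < r := hr
  have ht' : (t : ℂ) ≠ 0 := by exact_mod_cast ht.ne'
  have hr' : ((1 + r : ℝ) : ℂ) ≠ 0 := by exact_mod_cast (by positivity : (1 + r : ℝ) ≠ 0)
  simp only [testFunction, Complex.real_smul]
  rw [show t + t * r = t * (1 + r) by ring, Complex.ofReal_mul t r,
    Complex.mul_cpow_ofReal_nonneg ht.le hr.le, Complex.ofReal_mul t (1 + r), mul_inv]
  field_simp

/-- After `s = t r` the only failure of the eigenvalue equation is the change of the truncation from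
`t` to `t r`. The error is a small multiple of the test function at the same point, so its `L²` norm
need never be computed. -/
lemma norm_carleman_testFunction_sub_le (μ : ℝ) {ε t : ℝ} (hε : 0 ≤ ε) (hε' : ε ≤ 1 / 8)
    (ht : 0 < t) :
    ‖(2 * Real.pi : ℂ)⁻¹ * (∫ s in Ioi (0 : ℝ), testFunction μ ε s * ((t + s : ℝ) : ℂ)⁻¹)
      - carlemanSymbol μ * testFunction μ ε t‖ ≤
      (8 * ε * ∫ r in Ioi (0 : ℝ), weight r) * ‖testFunction μ ε t‖ := by
  set k : ℝ → ℂ := fun r => (r : ℂ) ^ (-1 / 2 + Complex.I * μ) * ((1 + r : ℝ) : ℂ)⁻¹ with hk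
  have hkm : Measurable k := by fun_prop
  have hknorm : ∀ r : ℝ, 0 < r → ‖k r‖ * Real.exp (1 / 4 * |Real.log r|) = weight r := by
    intro r hr
    rw [hk, norm_mul, norm_cpow_symbol μ hr, norm_inv, Complex.norm_real,
      Real.norm_of_nonneg (by positivity), weight]
    ring
  have hkint : Integrable k posMeasure := by
    refine integrable_weight.mono' hkm.aestronglyMeasurable ?_
    filter_upwards [ae_restrict_mem measurableSet_Ioi] with r hr
    rw [← hknorm r hr]
    exact le_mul_of_one_le_right (norm_nonneg _) (Real.one_le_exp (by positivity))
  have hkint2 : Integrable (fun r => k r * (Real.exp (-ε * |Real.log (t * r)|) : ℂ))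
      posMeasure := by
    refine hkint.mono (hkm.aestronglyMeasurable.mul
      (Measurable.aestronglyMeasurable (by fun_prop))) (ae_of_all _ fun r => ?_)
    rw [norm_mul, Complex.norm_real, Real.norm_of_nonneg (Real.exp_pos _).le]
    refine mul_le_of_le_one_right (norm_nonneg _) (Real.exp_le_one_iff.2 ?_)
    have : 0 ≤ ε * |Real.log (t * r)| := by positivity
    linarith
  have e : (2 * Real.pi : ℂ)⁻¹ * (∫ s in Ioi (0 : ℝ), testFunction μ ε s * ((t + s : ℝ) : ℂ)⁻¹)
      - carlemanSymbol μ * testFunction μ ε t =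
      (2 * Real.pi : ℂ)⁻¹ * ((t : ℂ) ^ (-1 / 2 + Complex.I * μ) *
        ∫ r in Ioi (0 : ℝ), k r * ((Real.exp (-ε * |Real.log (t * r)|) -
          Real.exp (-ε * |Real.log t|) : ℝ) : ℂ)) := by
    have e1 : ∫ r in Ioi (0 : ℝ), k r * ((Real.exp (-ε * |Real.log (t * r)|) -
          Real.exp (-ε * |Real.log t|) : ℝ) : ℂ) =
        (∫ r in Ioi (0 : ℝ), k r * (Real.exp (-ε * |Real.log (t * r)|) : ℂ)) -
          (∫ r in Ioi (0 : ℝ), k r) * (Real.exp (-ε * |Real.log t|) : ℂ) := by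
      rw [← integral_mul_const, ← integral_sub hkint2 (hkint.mul_const _)]
      simp only [Complex.ofReal_sub, mul_sub]
    rw [integral_testFunction μ ε ht, carlemanSymbol_eq, e1, testFunction]
    ring
  have hbound : ‖∫ r in Ioi (0 : ℝ), k r * ((Real.exp (-ε * |Real.log (t * r)|) -
          Real.exp (-ε * |Real.log t|) : ℝ) : ℂ)‖ ≤
      ∫ r in Ioi (0 : ℝ), 8 * ε * Real.exp (-ε * |Real.log t|) * weight r := by
    refine norm_integral_le_of_norm_le (integrable_weight.const_mul _) ?_
    filter_upwards [ae_restrict_mem measurableSet_Ioi] with r hr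
    rw [norm_mul, Complex.norm_real, Real.norm_eq_abs, ← hknorm r hr]
    calc ‖k r‖ * |Real.exp (-ε * |Real.log (t * r)|) - Real.exp (-ε * |Real.log t|)|
        ≤ ‖k r‖ * (Real.exp (-ε * |Real.log t|) * (8 * ε * Real.exp (1 / 4 * |Real.log r|))) := by
          gcongr
          exact abs_truncation_sub_le hε hε' ht hr
      _ = _ := by ring
  rw [e, norm_mul, norm_mul, norm_cpow_symbol μ ht, norm_testFunction μ ε ht]
  rw [integral_const_mul] at hbound
  have hpi : ‖(2 * Real.pi : ℂ)⁻¹‖ ≤ 1 := by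
    rw [norm_inv, norm_mul, Complex.norm_real, Real.norm_of_nonneg Real.pi_pos.le]
    refine inv_le_one_of_one_le₀ ?_
    rw [Complex.norm_ofNat]
    linarith [Real.pi_gt_three]
  calc ‖(2 * Real.pi : ℂ)⁻¹‖ * (t ^ (-1 / 2 : ℝ) * _)
      ≤ 1 * (t ^ (-1 / 2 : ℝ) *
        (8 * ε * Real.exp (-ε * |Real.log t|) * ∫ r in Ioi (0 : ℝ), weight r)) := by gcongr
    _ = _ := by ring

end TestFunctions

/-! ### Approximate eigenvectors of the Carleman operator -/

section ApproximateEigenvectors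

lemma integral_norm_mul_norm_le {α : Type*} {m : MeasurableSpace α} {μ : Measure α}
    (f g : Lp ℂ 2 μ) : ∫ a, ‖f a‖ * ‖g a‖ ∂μ ≤ ‖f‖ * ‖g‖ := by
  have hpq : (2 : ℝ).HolderConjugate 2 := by
    rw [Real.holderConjugate_iff]; norm_num
  have h2 : ENNReal.ofReal 2 = 2 := by norm_num
  have hroot : ∀ h : Lp ℂ 2 μ, (∫ a, ‖h a‖ ^ (2 : ℝ) ∂μ) ^ (1 / (2 : ℝ)) = ‖h‖ := by
    intro h
    simp_rw [Real.rpow_two]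
    rw [← norm_sq_eq_integral, ← Real.sqrt_eq_rpow, Real.sqrt_sq (norm_nonneg _)]
  have := integral_mul_norm_le_Lp_mul_Lq hpq (f := f) (g := g) (by rw [h2]; exact Lp.memLp f)
    (by rw [h2]; exact Lp.memLp g)
  rwa [hroot, hroot] at this

/-- The test function as an element of `L²(ℝ⁺)`. -/
def testVector (μ : ℝ) {ε : ℝ} (hε : 0 < ε) : L2Pos := (memLp_testFunction μ hε).toLp _

lemma coeFn_testVector (μ : ℝ) {ε : ℝ} (hε : 0 < ε) :
    (testVector μ hε : ℝ → ℂ) =ᵐ[posMeasure] testFunction μ ε :=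
  MemLp.coeFn_toLp _

lemma testVector_ne_zero (μ : ℝ) {ε : ℝ} (hε : 0 < ε) : testVector μ hε ≠ 0 := by
  intro h
  have h1 := (Lp.eq_zero_iff_ae_eq_zero.1 h).symm.trans (coeFn_testVector μ hε)
  have h2 : ∀ᵐ _t ∂posMeasure, False := by
    filter_upwards [h1, ae_restrict_mem measurableSet_Ioi] with t ht ht0
    have h3 := norm_testFunction μ ε ht0
    rw [← ht] at h3
    have : 0 < t ^ (-1 / 2 : ℝ) * Real.exp (-ε * |Real.log t|) :=
      mul_pos (Real.rpow_pos_of_pos ht0 _) (Real.exp_pos _)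
    rw [← h3] at this
    simp at this
  rw [eventually_false_iff_eq_bot, ae_eq_bot, Measure.restrict_eq_zero] at h2
  simp at h2

lemma integrable_kernel_testFunction (μ : ℝ) {ε a : ℝ} (b : ℝ) (hε : 0 < ε) (ha : 0 < a)
    (y : L2Pos) :
    Integrable (fun p : ℝ × ℝ => ‖cutoff a b y p.1‖ * (‖testFunction μ ε p.2‖ * (a + p.2)⁻¹))
      (posMeasure.prod posMeasure) :=
  (integrable_cutoff a b y).norm.mul_prod (integrable_norm_testFunction_mul μ hε ha)

lemma ae_norm_kernel_le {a : ℝ} (b : ℝ) (ha : 0 < a) (y : L2Pos) :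
    ∀ᵐ p ∂(posMeasure.prod posMeasure), ∀ w : ℂ,
      ‖conj (cutoff a b y p.1) * w * ((p.1 + p.2 : ℝ) : ℂ)⁻¹‖ ≤
        ‖cutoff a b y p.1‖ * (‖w‖ * (a + p.2)⁻¹) := by
  filter_upwards [Measure.quasiMeasurePreserving_fst.ae (cutoff_ae_ne_zero a b y),
    Measure.quasiMeasurePreserving_snd.ae (ae_restrict_mem (μ := volume) measurableSet_Ioi)]
    with p h1 h2 w
  have h2 : 0 < p.2 := h2
  by_cases h0 : cutoff a b y p.1 = 0
  · simp [h0]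
  have h3 := (h1 h0).1
  rw [norm_mul, norm_mul, RCLike.norm_conj, mul_assoc, norm_inv, Complex.norm_real,
    Real.norm_of_nonneg (by linarith)]
  gcongr

lemma aestronglyMeasurable_kernel {f g : ℝ → ℂ} (hf : AEStronglyMeasurable f posMeasure)
    (hg : AEStronglyMeasurable g posMeasure) :
    AEStronglyMeasurable (fun p : ℝ × ℝ => conj (f p.1) * g p.2 * ((p.1 + p.2 : ℝ) : ℂ)⁻¹)
      (posMeasure.prod posMeasure) :=
  ((Complex.continuous_conj.comp_aestronglyMeasurable hf.comp_fst).mul hg.comp_snd).mul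
    (Measurable.aestronglyMeasurable (by fun_prop))

lemma integrable_carleman_kernel (μ : ℝ) {ε a : ℝ} (b : ℝ) (hε : 0 < ε) (ha : 0 < a) (y : L2Pos) :
    Integrable (fun p : ℝ × ℝ => conj (cutoff a b y p.1) * testFunction μ ε p.2 *
      ((p.1 + p.2 : ℝ) : ℂ)⁻¹) (posMeasure.prod posMeasure) := by
  refine (integrable_kernel_testFunction μ b hε ha y).mono' (aestronglyMeasurable_kernel
    (Lp.aestronglyMeasurable _) (measurable_testFunction μ ε).aestronglyMeasurable) ?_
  filter_upwards [ae_norm_kernel_le b ha y] with p hp using hp _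

/-- The kernel formula is known only for cutoff functions. It extends to the test vector by
dominated convergence, since `t ≥ a` on the support of the cutoff keeps the kernel below `(a +
s)⁻¹`. -/
lemma inner_carleman_testVector (μ : ℝ) {ε a : ℝ} (b : ℝ) (hε : 0 < ε) (ha : 0 < a) (y : L2Pos) :
    ⟪cutoff a b y, carleman (testVector μ hε)⟫_ℂ = ∫ t in Ioi (0 : ℝ), conj (cutoff a b y t) *
      ((2 * Real.pi : ℂ)⁻¹ *
        ∫ s in Ioi (0 : ℝ), testFunction μ ε s * ((t + s : ℝ) : ℂ)⁻¹) := by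
  have hbound := integrable_kernel_testFunction μ b hε ha y
  have hle := ae_norm_kernel_le b ha y
  have hint := integrable_carleman_kernel μ b hε ha y
  have hlim1 : Tendsto (fun n => ⟪cutoff a b y, carleman (cutoffSeq n (testVector μ hε))⟫_ℂ) atTop
      (𝓝 ⟪cutoff a b y, carleman (testVector μ hε)⟫_ℂ) :=
    tendsto_const_nhds.inner ((carleman.continuous.tendsto _).comp (tendsto_cutoffSeq _))
  have hlim2 : Tendsto (fun n : ℕ => ∫ p, conj (cutoff a b y p.1) *
      cutoffSeq n (testVector μ hε) p.2 * ((p.1 + p.2 : ℝ) : ℂ)⁻¹ ∂(posMeasure.prod posMeasure))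
      atTop (𝓝 (∫ p, conj (cutoff a b y p.1) * testFunction μ ε p.2 *
        ((p.1 + p.2 : ℝ) : ℂ)⁻¹ ∂(posMeasure.prod posMeasure))) := by
    have hae : ∀ n : ℕ, ∀ᵐ s ∂posMeasure, cutoffSeq n (testVector μ hε) s =
        (Icc (1 / ((n : ℝ) + 1)) ((n : ℝ) + 1)).indicator (testFunction μ ε) s := by
      intro n
      filter_upwards [coeFn_cutoff (1 / ((n : ℝ) + 1)) ((n : ℝ) + 1) (testVector μ hε),
        coeFn_testVector μ hε] with s h1 h2
      rw [cutoffSeq, h1]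
      by_cases h : s ∈ Icc (1 / ((n : ℝ) + 1)) ((n : ℝ) + 1)
      · rw [indicator_of_mem h, indicator_of_mem h, h2]
      · rw [indicator_of_notMem h, indicator_of_notMem h]
    refine tendsto_integral_of_dominated_convergence _ (fun n => aestronglyMeasurable_kernel
      (Lp.aestronglyMeasurable _) (Lp.aestronglyMeasurable _)) hbound (fun n => ?_) ?_
    · filter_upwards [hle, Measure.quasiMeasurePreserving_snd.ae (hae n),
        Measure.quasiMeasurePreserving_snd.ae (ae_restrict_mem (μ := volume) measurableSet_Ioi)]
        with p h1 h2 h3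
      have h3 : 0 < p.2 := h3
      refine (h1 _).trans ?_
      gcongr
      rw [h2]
      exact norm_indicator_le_norm_self _ _
    · filter_upwards [Measure.quasiMeasurePreserving_snd.ae (ae_all_iff.2 hae),
        Measure.quasiMeasurePreserving_snd.ae (ae_restrict_mem (μ := volume) measurableSet_Ioi)]
        with p h1 h2
      refine Tendsto.mul_const _ (Tendsto.const_mul _ (tendsto_const_nhds.congr' ?_))
      filter_upwards [eventually_mem_Icc h2] with n hn
      rw [h1 n, indicator_of_mem hn]
  have heq : ∀ n : ℕ, ⟪cutoff a b y, carleman (cutoffSeq n (testVector μ hε))⟫_ℂ =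
      (2 * Real.pi : ℂ)⁻¹ * ∫ p, conj (cutoff a b y p.1) *
        cutoffSeq n (testVector μ hε) p.2 * ((p.1 + p.2 : ℝ) : ℂ)⁻¹
          ∂(posMeasure.prod posMeasure) := fun n => inner_carleman ha (by positivity) y _
  simp_rw [heq] at hlim1
  rw [tendsto_nhds_unique hlim1 (hlim2.const_mul _), integral_prod _ hint, ← integral_const_mul]
  refine integral_congr_ae (ae_of_all _ fun t => ?_)
  simp only [mul_assoc]
  rw [integral_const_mul]
  ring

lemma norm_carleman_testVector_sub_le (μ : ℝ) {ε : ℝ} (hε : 0 < ε) (hε' : ε ≤ 1 / 8) :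
    ‖carleman (testVector μ hε) - carlemanSymbol μ • testVector μ hε‖ ≤
      (8 * ε * ∫ r in Ioi (0 : ℝ), weight r) * ‖testVector μ hε‖ := by
  set c := 8 * ε * ∫ r in Ioi (0 : ℝ), weight r with hc
  have hc0 : 0 ≤ c := by
    have : 0 ≤ ∫ r in Ioi (0 : ℝ), weight r :=
      setIntegral_nonneg measurableSet_Ioi fun r hr => by
        have hr : 0 < r := hr
        unfold weight; positivity
    positivity
  have key : ∀ a b : ℝ, 0 < a → ∀ y, ‖⟪cutoff a b y,
      carleman (testVector μ hε) - carlemanSymbol μ • testVector μ hε⟫_ℂ‖ ≤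
      ‖cutoff a b y‖ * (c * ‖testVector μ hε‖) := by
    intro a b ha y
    have h1 : ⟪cutoff a b y, carleman (testVector μ hε) - carlemanSymbol μ • testVector μ hε⟫_ℂ =
        ∫ t in Ioi (0 : ℝ), conj (cutoff a b y t) * ((2 * Real.pi : ℂ)⁻¹ *
          (∫ s in Ioi (0 : ℝ), testFunction μ ε s * ((t + s : ℝ) : ℂ)⁻¹)
            - carlemanSymbol μ * testFunction μ ε t) := by
      have h2 : ⟪cutoff a b y, carlemanSymbol μ • testVector μ hε⟫_ℂ =
          ∫ t in Ioi (0 : ℝ), conj (cutoff a b y t) * (carlemanSymbol μ * testFunction μ ε t) := by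
        rw [inner_smul_right, L2.inner_def, ← integral_const_mul]
        refine integral_congr_ae ?_
        filter_upwards [coeFn_testVector μ hε] with t ht
        rw [ht, RCLike.inner_apply]
        ring
      have hi1 : Integrable (fun t => conj (cutoff a b y t) *
          (carlemanSymbol μ * testFunction μ ε t)) posMeasure := by
        refine ((L2.integrable_inner (𝕜 := ℂ) (cutoff a b y)
          (testVector μ hε)).const_mul (carlemanSymbol μ)).congr ?_
        filter_upwards [coeFn_testVector μ hε] with t ht
        rw [ht, RCLike.inner_apply]
        ring
      have hi2 : Integrable (fun t => conj (cutoff a b y t) * ((2 * Real.pi : ℂ)⁻¹ *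
          ∫ s in Ioi (0 : ℝ), testFunction μ ε s * ((t + s : ℝ) : ℂ)⁻¹)) posMeasure := by
        have hint := integrable_carleman_kernel μ b hε ha y
        refine (hint.integral_prod_left.const_mul (2 * Real.pi : ℂ)⁻¹).congr
          (ae_of_all _ fun t => ?_)
        simp only [mul_assoc]
        rw [integral_const_mul]
        ring
      rw [inner_sub_right, inner_carleman_testVector μ b hε ha, h2, ← integral_sub hi2 hi1]
      simp only [mul_sub]
    rw [h1]
    calc _ ≤ ∫ t in Ioi (0 : ℝ), c * (‖cutoff a b y t‖ * ‖testVector μ hε t‖) := by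
          refine norm_integral_le_of_norm_le ?_ ?_
          · refine Integrable.const_mul ?_ c
            refine (L2.integrable_inner (𝕜 := ℂ) (cutoff a b y) (testVector μ hε)).norm.congr ?_
            refine ae_of_all _ fun t => ?_
            simp only [RCLike.inner_apply, norm_mul, RCLike.norm_conj]
            ring
          · filter_upwards [coeFn_testVector μ hε, ae_restrict_mem measurableSet_Ioi] with t ht ht0
            rw [norm_mul, RCLike.norm_conj, ht, mul_left_comm]
            gcongr
            exact norm_carleman_testFunction_sub_le μ hε.le hε' ht0
      _ ≤ c * (‖cutoff a b y‖ * ‖testVector μ hε‖) := by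
          rw [integral_const_mul]
          gcongr
          exact integral_norm_mul_norm_le _ _
      _ = _ := by ring
  set g := carleman (testVector μ hε) - carlemanSymbol μ • testVector μ hε
  -- The bound is tested on cutoffs of the error `g` itself; the limit reads `‖g‖² ≤ ‖g‖ · c‖x‖`,
  -- where `x` is the test vector.
  have hlim := le_of_tendsto_of_tendsto' (tendsto_inner_cutoffSeq g g).norm
    ((tendsto_cutoffSeq g).norm.mul_const (c * ‖testVector μ hε‖))
    (fun n => key _ _ (by positivity) g)
  rw [inner_self_ofReal, Complex.norm_real, Real.norm_of_nonneg (by positivity), pow_two] at hlim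
  rcases eq_or_ne g 0 with hg | hg
  · rw [hg, norm_zero]; positivity
  · exact le_of_mul_le_mul_left hlim (norm_pos_iff.2 hg)

lemma exists_approx_carlemanSymbol (μ : ℝ) :
    ∀ η > 0, ∃ x : L2Pos, ‖x‖ = 1 ∧ ‖carleman x - carlemanSymbol μ • x‖ ≤ η := by
  intro η hη
  set K := ∫ r in Ioi (0 : ℝ), weight r with hK
  have hK0 : 0 ≤ K := setIntegral_nonneg measurableSet_Ioi fun r hr => by
    have hr : 0 < r := hr
    unfold weight; positivity
  set ε := min (1 / 8) (η / (8 * (K + 1))) with hεdef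
  have hε : 0 < ε := by positivity
  have hεK : 8 * ε * K ≤ η := by
    have h1 : ε ≤ η / (8 * (K + 1)) := min_le_right _ _
    rw [le_div_iff₀ (by positivity)] at h1
    nlinarith
  have hx := norm_pos_iff.2 (testVector_ne_zero μ hε)
  refine ⟨((‖testVector μ hε‖⁻¹ : ℝ) : ℂ) • testVector μ hε, norm_inv_norm_smul hx,
    norm_apply_inv_norm_smul_sub_le carleman _ hx ?_⟩
  refine (norm_carleman_testVector_sub_le μ hε (min_le_left _ _)).trans ?_
  rw [mul_comm]
  gcongr

/-- An approximate eigenvalue of an operator with real quadratic form is real, so the symbol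
integral need not be evaluated. -/
lemma carlemanSymbol_im (μ : ℝ) : (carlemanSymbol μ).im = 0 := by
  refine abs_eq_zero.1 (le_antisymm (le_of_forall_pos_le_add fun η hη => ?_) (abs_nonneg _))
  obtain ⟨x, hx, hxη⟩ := exists_approx_carlemanSymbol μ η hη
  obtain ⟨c, hc, -⟩ := isHalfUnitary_truncatedFourier.inner_C x
  have h1 : ⟪x, carleman x - carlemanSymbol μ • x⟫_ℂ = c - carlemanSymbol μ := by
    rw [inner_sub_right, hc, inner_smul_right, inner_self_ofReal, hx]; simp
  have h2 := (Complex.abs_im_le_norm _).trans (norm_inner_le_norm (𝕜 := ℂ) x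
    (carleman x - carlemanSymbol μ • x))
  rw [h1, hx, one_mul, Complex.sub_im, Complex.ofReal_im, zero_sub, abs_neg] at h2
  linarith

lemma exists_approx_carleman (l : ℝ) (hl : 0 < l) (hl2 : l < 1 / 2) :
    ∀ ε > 0, ∃ x : L2Pos, ‖x‖ = 1 ∧ ‖carleman x - (l : ℂ) • x‖ ≤ ε := by
  obtain ⟨μ, hμ⟩ := exists_carlemanSymbol_re_eq hl hl2
  have h1 : carlemanSymbol μ = (l : ℂ) := by
    refine Complex.ext ?_ ?_
    · rw [hμ, Complex.ofReal_re]
    · rw [carlemanSymbol_im, Complex.ofReal_im]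
  rw [← h1]
  exact exists_approx_carlemanSymbol μ

end ApproximateEigenvectors

end TruncatedFourier

end

open TruncatedFourier in
theorem theorem4p6 :
    spectrum ℂ truncatedFourier = segment ℝ (-endpoint) endpoint ∧
    ∀ ζ ∈ spectrum ℂ truncatedFourier,
      (∀ z ∈ normalLine ζ, z ≠ ζ →
        z ∈ resolventSet ℂ truncatedFourier ∧
        (ζ ≠ 0 →
          ‖resolvent truncatedFourier z‖ ≤ A z * (1 / ‖ζ‖) * (1 / ‖z - ζ‖)) ∧
        (‖z - ζ‖ ≤ ‖ζ‖ →
          A z * (1 / ‖ζ‖) * (1 / ‖z - ζ‖) - B z * ‖ζ‖ * ‖z - ζ‖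
            ≤ ‖resolvent truncatedFourier z‖) ∧
        (ζ = 0 →
          2 * A z * (1 / ‖z‖ ^ 2) - B z * (‖z‖ ^ 2 / 2) ≤ ‖resolvent truncatedFourier z‖ ∧
          (‖z‖ ^ 2 ≤ 2 →
            2 * A z * (1 / ‖z‖ ^ 2) - B z ≤ ‖resolvent truncatedFourier z‖) ∧
          ‖resolvent truncatedFourier z‖ ≤ 2 * A z * (1 / ‖z‖ ^ 2))) ∧
      (ζ ≠ 0 →
        (fun z : ℂ => ‖resolvent truncatedFourier z‖ - A ζ / ‖ζ‖ * (1 / ‖z - ζ‖))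
          =O[𝓝[normalLine ζ \ {ζ}] ζ] (fun _ : ℂ => (1 : ℝ))) ∧
      (ζ = 0 →
        (fun z : ℂ => ‖resolvent truncatedFourier z‖ - (‖z‖ ^ 2)⁻¹)
          =O[𝓝[normalLine ζ \ {ζ}] ζ] (fun _ : ℂ => (1 : ℝ))) := by
  exact isHalfUnitary_truncatedFourier.resolvent_estimates exists_approx_carleman
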